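/- **Conventions.** Let $(W,S)$ be a Coxeter system with Coxeter matrix $m:S\times S\to\mathbb Z_{>0}\cup\{\infty\}$. Its Coxeter graph has vertex set $S$ and an edge between $s\neq t$ when $m(s,t)\ge 3$, labelled by $m(s,t)$ when $m(s,t)>3$. A *bw-Coxeter graph* is a Coxeter graph whose vertices are coloured black or white. For $J\subset S$, the bw-Coxeter graph of $(W,W_J)$ is the Coxeter graph of $(W,S)$ with the vertices in $J$ white and the others black. $W^J$ denotes the set of shortest representatives of the cosets $W/W_J$, and $\le_B$ the Bruhat order. **The graph of a pointed poset.** Let $(X,\le)$ be a poset with a least element and a rank function $\rho$ (normalised to be $0$ at the least element), and put $X_i=\rho^{-1}(i)$. We write $b\lhd a$ if $a$ covers $b$. For $a,b\in X_1$ let $X_2(a,b)$ be the set of $x\in X_2$ for which $\{y : y\lhd x\}=\{a,b\}$, let $$X^0(a,b)=X_0\cup\{a,b\}\cup\{x\in X : \rho(x)>1,\ y\in X_2(a,b)\text{ for all } y\in X_2 \text{ with } y\le x\},$$ and let $\mu(a,b)=\sup\{\rho(x): x\in X^0(a,b)\}\in\mathbb N\cup\{\infty\}$. Let $VX$ be the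 set of $x\in X$ with $\rho(x)>0$ such that for every $i$ there is at most one $y\in X_i$ with $y\le x$. The bw-Coxeter graph $\mathcal G(X,\le)$ has vertex set $VX$; the vertices in $X_1$ are black and those in $VX\setminus X_1$ are white. Its edges are: * an edge between distinct $a,b\in X_1$ when $\mu(a,b)\ge3$, labelled $\mu(a,b)$ if $\mu(a,b)>3$; * an unlabelled edge between $x$ and $y$ for each covering $x\lhd y$ with $x,y\in VX$; * an edge (unlabelled, unless already present by the first rule) between $a\in X_1$ and $x\in VX$ whenever $x$ is minimal with the property that $a\not\le x$ and there exist $x_1\neq x_2$ in $X$ with $x\lhd x_1$, $x\lhd x_2$, $a\le x_1$ and $a\le x_2$. **Duplication procedure.** Given a bw-Coxeter graph whose underlying graph is a tree and which has labels only on edges between two black vertices, its duplication is the following bw-Coxeter graph. The black vertices and the (labelled) edges between them are kept. Each connected component $C$ of the subgraph of white vertices is replaced by one copy of $C$ for each black vertex that has a neighbour in $C$. In each copy the edges inside $C$ are kept and each vertex is joined to the same black vertices as the original vertex of $C$. There are no edges between different copies. **Theorem 3.7.** Let $(W,S)$ be a Coxeter system whose Coxeter graph is a tree (connected and without cycles,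 ignoring labels), and let $J\subset S$ be such that no edge which meets $J$ is labelled. Then the bw-Coxeter graph $\mathcal G(W^J,\le_B)$ is isomorphic to the duplication of the bw-Coxeter graph of $(W,W_J)$, by an isomorphism which respects edges, labels and colours and which identifies the black vertices $S\setminus J$ with $(W^J)_1=S\setminus J$ by the identity. -/

import Mathlib

/-! ### Coxeter graphs and bw-Coxeter graphs

Coxeter matrices are Mathlib's, so that the entry `0` stands for `∞`. -/

/-- The graph underlying the Coxeter graph of a Coxeter matrix `M`: distinct vertices are joined when
their entry is at least `3` or infinite (recall that `0` encodes `∞`), i.e. when it is not `2`. -/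
def CoxeterMatrix.coxeterGraph {V : Type*} (M : CoxeterMatrix V) : SimpleGraph V where
  Adj s t := s ≠ t ∧ M s t ≠ 2
  symm := ⟨fun s t h => ⟨h.1.symm, by rw [M.symmetric]; exact h.2⟩⟩
  loopless := ⟨fun _ h => h.1 rfl⟩

/-- A bw-Coxeter graph: a Coxeter graph, encoded by its Coxeter matrix (entry `2`: no edge,
entry `3`: unlabelled edge, any other off-diagonal entry: edge with that label, `0` being `∞`),
together with the set of black vertices. The other vertices are white. -/
structure BWCoxeterGraph (V : Type*) where
  /-- The Coxeter matrix. -/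
  M : CoxeterMatrix V
  /-- The set of black vertices. -/
  black : Set V

namespace BWCoxeterGraph

/-- Isomorphisms of bw-Coxeter graphs: bijections on vertices which respect edges, labels and
colours. -/
structure Iso {V V' : Type*} (G : BWCoxeterGraph V) (G' : BWCoxeterGraph V') extends V ≃ V' where
  map_M : ∀ x y, G'.M (toFun x) (toFun y) = G.M x y
  map_black : ∀ x, toFun x ∈ G'.black ↔ x ∈ G.black

/-- The full subgraph on the white vertices. -/
def whiteGraph {V : Type*} (G : BWCoxeterGraph V) : SimpleGraph ↥(G.blackᶜ) :=
  G.M.coxeterGraph.induce G.blackᶜ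

/-- The connected components of the subgraph of white vertices. -/
abbrev WhiteComponent {V : Type*} (G : BWCoxeterGraph V) : Type _ :=
  G.whiteGraph.ConnectedComponent

/-- The black vertices which neighbour a white component. -/
def blackNeighbours {V : Type*} (G : BWCoxeterGraph V) (C : G.WhiteComponent) : Set V :=
  {s | s ∈ G.black ∧ ∃ t ∈ C.supp, G.M.coxeterGraph.Adj s t}

/-- The vertices of the graph obtained by duplication: the old black vertices, and for each white
component `C` and each black neighbour `s` of `C` one copy of every vertex of `C`. -/
abbrev DupVertex {V : Type*} (G : BWCoxeterGraph V) : Type _ :=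
  ↥G.black ⊕ (Σ C : G.WhiteComponent, ↥(G.blackNeighbours C) × ↥C.supp)

open Classical in
/-- The Coxeter matrix of the duplicated graph. Black vertices are connected as before, each copy
of a component has the edges of the component, each vertex in a copy is attached to the black
vertices exactly as the original vertex, and there are no edges between different copies. -/
noncomputable def dupEntry {V : Type*} (G : BWCoxeterGraph V) : G.DupVertex → G.DupVertex → ℕ
  | .inl a, .inl b => G.M (a : V) (b : V)
  | .inl a, .inr y => G.M (a : V) (y.2.2.1 : V)
  | .inr x, .inl b => G.M (x.2.2.1 : V) (b : V)
  | .inr x, .inr y =>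
    if x.1 = y.1 ∧ (x.2.1 : V) = (y.2.1 : V) then G.M (x.2.2.1 : V) (y.2.2.1 : V) else 2

/-- The duplication procedure: the black part is kept, and each connected component of the white
part is replaced by as many copies, identically attached to the black vertices, as the component
has black neighbours. -/
noncomputable def duplicate {V : Type*} (G : BWCoxeterGraph V) : BWCoxeterGraph G.DupVertex where
  M :=
    { M := Matrix.of G.dupEntry
      isSymm := by
        apply Matrix.IsSymm.ext
        rintro (a | x) (b | y)
        · exact G.M.symmetric _ _
        · exact G.M.symmetric _ _
        · exact G.M.symmetric _ _
        · simp only [Matrix.of_apply, dupEntry]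
          rw [G.M.symmetric (y.2.2.1 : V)]
          congr 1
          exact propext (and_congr eq_comm eq_comm)
      diagonal := by
        rintro (a | x) <;> simp [dupEntry]
      off_diagonal := by
        rintro (a | x) (b | y) hne
        · refine G.M.off_diagonal _ _ fun h => hne ?_
          rw [Subtype.ext h]
        · refine G.M.off_diagonal _ _ fun h => ?_
          exact y.2.2.1.2 (h ▸ a.2)
        · refine G.M.off_diagonal _ _ fun h => ?_
          exact x.2.2.1.2 (h ▸ b.2)
        · simp only [Matrix.of_apply, dupEntry]
          split_ifs with h
          · refine G.M.off_diagonal _ _ fun h' => hne ?_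
            obtain ⟨C, s, t⟩ := x
            obtain ⟨C', s', t'⟩ := y
            obtain ⟨h1, h2⟩ := h
            dsimp only at h1 h2 h'
            subst h1
            rw [Subtype.ext h2, Subtype.ext (Subtype.ext h')]
          · decide }
  black := Set.range Sum.inl

end BWCoxeterGraph

/-! ### The bw-Coxeter graph of a poset

The rank of an element of a pointed poset is its height, see `PointedPoset.height_eq_rank`. So the
layers can be defined from the order alone. -/

namespace PointedPoset

/-- In a poset with a least element and a (normalised, strictly monotone) rank function, the rank
of an element is its height. -/
theorem height_eq_rank {X : Type*} [PartialOrder X] [OrderBot X] (ρ : X → ℕ)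
    (hmono : StrictMono ρ) (hcov : ∀ a b : X, b ⋖ a → ρ a = ρ b + 1) (h0 : ∃ x, ρ x = 0) (x : X) :
    Order.height x = ρ x := by
  have hbot : ρ ⊥ = 0 := by
    obtain ⟨y, hy⟩ := h0
    have := hmono.monotone (bot_le : ⊥ ≤ y)
    omega
  have key : ∀ n : ℕ, ∀ x : X, ρ x = n → Order.height x = n := by
    intro n
    induction n using Nat.strong_induction_on with
    | _ n ih =>
      intro x hx
      apply le_antisymm
      · refine Order.height_le_coe_iff.2 fun y hy => ?_
        have hlt := hmono hy
        rw [ih (ρ y) (hx ▸ hlt) y rfl]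
        exact_mod_cast hx ▸ hlt
      · by_cases hb : x = ⊥
        · subst hb
          rw [hbot] at hx
          simp [← hx]
        · have hne : ∃ k, k ≤ ρ x ∧ ∃ y, y < x ∧ ρ y = k :=
            ⟨ρ ⊥, by omega, ⊥, bot_lt_iff_ne_bot.2 hb, rfl⟩
          classical
          obtain ⟨y, hy, hyk⟩ := Nat.findGreatest_spec (P := fun k => ∃ y, y < x ∧ ρ y = k)
            hne.choose_spec.1 hne.choose_spec.2
          have hyx : y ⋖ x := by
            refine ⟨hy, fun c hc hcx => ?_⟩
            have h1 := hmono hc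
            have h2 := Nat.le_findGreatest (P := fun k => ∃ y, y < x ∧ ρ y = k)
              (hmono hcx).le ⟨c, hcx, rfl⟩
            omega
          have h3 := hcov x y hyx
          have h4 := ih (ρ y) (by omega) y rfl
          have h5 := Order.height_add_one_le hy
          rw [h4, ← Nat.cast_one, ← Nat.cast_add, ← h3, hx] at h5
          exact h5
  exact key _ x rfl

variable (X : Type*) [PartialOrder X]

/-- The set `X_i` of elements of rank `i`. -/
def layer (i : ℕ) : Set X := {x | Order.height x = i}

variable {X}

/-- `X_2(I)`: the elements of rank `2` which cover precisely the elements of `I`. -/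
def layerTwo (I : Set X) : Set X := {x | x ∈ layer X 2 ∧ ∀ y, y ⋖ x ↔ y ∈ I}

/-- `X^0(I)`: the elements of rank `0`, those in `I`, and the elements of rank at least `2` which
are only above elements of rank `2` that belong to `X_2(I)`. -/
def lowerPart (I : Set X) : Set X :=
  layer X 0 ∪ I ∪ {x | (∃ i, 1 < i ∧ x ∈ layer X i) ∧ ∀ y ∈ layer X 2, y ≤ x → y ∈ layerTwo I}

/-- `μ(a,b)`: the length of the poset `X^0(a,b)`, i.e. the supremum of the ranks it meets. -/
noncomputable def mu (a b : X) : ℕ∞ :=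
  ⨆ i ∈ {i : ℕ | ((layer X i) ∩ lowerPart {a, b}).Nonempty}, (i : ℕ∞)

variable (X) in
/-- `VX`: the elements of positive rank which are above at most one element of each rank. -/
def VX : Set X :=
  {x | (∃ i, 0 < i ∧ x ∈ layer X i) ∧
    ∀ i : ℕ, ∀ y ∈ layer X i, ∀ z ∈ layer X i, y ≤ x → z ≤ x → y = z}

/-- `x` is not above `a`, but it has two different covers that are. -/
def TwoCoversAbove (a x : X) : Prop :=
  ¬ a ≤ x ∧ ∃ x₁ x₂ : X, x₁ ≠ x₂ ∧ x ⋖ x₁ ∧ x ⋖ x₂ ∧ a ≤ x₁ ∧ a ≤ x₂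

/-- The rule which joins an element `a` of rank one to the elements `x` that are minimal with the
property `TwoCoversAbove a x`. -/
def Attached (a x : X) : Prop := a ∈ layer X 1 ∧ Minimal (TwoCoversAbove a) x

open Classical in
/-- The entries of the Coxeter matrix of the bw-Coxeter graph of a poset: black vertices `x, y`
with `3 ≤ μ(x,y)` are joined by an edge with label `μ(x,y)` (`∞` becomes `0`, and `3` means no
label). All remaining edges are unlabelled: they come from coverings within `VX` and from the rule
`Attached`. -/
noncomputable def entry (x y : X) : ℕ :=
  if x = y then 1
  else if x ∈ layer X 1 ∧ y ∈ layer X 1 ∧ 3 ≤ mu x y then (mu x y).toNat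
  else if x ⋖ y ∨ y ⋖ x ∨ Attached x y ∨ Attached y x then 3
  else 2

theorem mu_comm (a b : X) : mu a b = mu b a := by
  simp only [mu, Set.pair_comm]

theorem entry_comm (x y : X) : entry x y = entry y x := by
  unfold entry
  rw [mu_comm y x]
  congr 1
  · exact propext eq_comm
  · congr 1
    · exact propext (by tauto)
    · congr 1
      exact propext (by tauto)

theorem entry_ne_one {x y : X} (h : x ≠ y) : entry x y ≠ 1 := by
  unfold entry
  rw [if_neg h]
  split_ifs with h1
  · intro h2
    obtain ⟨-, -, h3⟩ := h1
    rw [(ENat.toNat_eq_iff one_ne_zero).1 h2] at h3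
    exact absurd (Nat.cast_le.1 h3) (by norm_num)
  · norm_num
  · norm_num

variable (X) in
/-- The bw-Coxeter graph `𝒢(X,≤)` of a pointed poset. Its vertices are the elements of `VX`, the
black ones are those of rank one. -/
noncomputable def bwGraph : BWCoxeterGraph ↥(VX X) where
  M :=
    { M := Matrix.of fun x y => entry (x : X) (y : X)
      isSymm := Matrix.IsSymm.ext fun x y => entry_comm _ _
      diagonal := fun x => by simp [entry]
      off_diagonal := fun x y h => entry_ne_one fun h' => h (Subtype.ext h') }
  black := {x | (x : X) ∈ layer X 1}

end PointedPoset

/-! ### Coxeter pairs and the Bruhat order on shortest coset representatives -/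

namespace CoxeterSystem

variable {B W : Type*} [Group W] {M : CoxeterMatrix B} (cs : CoxeterSystem M W)

/-- The bw-Coxeter graph of the Coxeter pair `(W, W_J)`: vertices in `J` are white. -/
def pairGraph (_cs : CoxeterSystem M W) (J : Set B) : BWCoxeterGraph B where
  M := M
  black := Jᶜ

/-- The Bruhat order: `u ≤ w` if there is a chain from `u` to `w` in which each step multiplies by
a reflection and increases the length. -/
def BruhatLE (u w : W) : Prop :=
  Relation.ReflTransGen
    (fun a b => ∃ t, cs.IsReflection t ∧ b = a * t ∧ cs.length a < cs.length b) u w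

theorem BruhatLE.length_lt_or_eq {cs : CoxeterSystem M W} {u w : W} (h : cs.BruhatLE u w) :
    u = w ∨ cs.length u < cs.length w := by
  induction h with
  | refl => exact Or.inl rfl
  | tail _ hs ih =>
    obtain ⟨t, -, -, hlt⟩ := hs
    right
    rcases ih with rfl | ih
    · exact hlt
    · exact ih.trans hlt

/-- The parabolic subgroup `W_J` generated by `J`. -/
def parabolic (J : Set B) : Subgroup W := Subgroup.closure (cs.simple '' J)

/-- `W^J`: the shortest representatives of the cosets in `W / W_J`. -/
def ShortestRep (J : Set B) : Type _ :=
  {w : W // ∀ u ∈ cs.parabolic J, cs.length w ≤ cs.length (w * u)}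

/-- The poset `(W^J, ≤_B)`. -/
instance (J : Set B) : PartialOrder (cs.ShortestRep J) where
  le u w := cs.BruhatLE u.1 w.1
  le_refl _ := Relation.ReflTransGen.refl
  le_trans _ _ _ h h' := Relation.ReflTransGen.trans h h'
  le_antisymm u w h h' := by
    apply Subtype.ext
    rcases h.length_lt_or_eq with h1 | h1
    · exact h1
    · rcases h'.length_lt_or_eq with h2 | h2
      · exact h2.symm
      · omega

end CoxeterSystem

/-! Call a path of the Coxeter graph white if its last vertex is black and all its other vertices
are white. Multiplying its letters gives an element of `W^J`, and these elements are exactly the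
members of `VX`. A vertex of the duplication is the same datum: a black vertex `s` is the path
`[s]`, and the vertex `t` in the copy belonging to `s` is the unique white path from `t` to `s`.

By the subword property, the elements below a white path come from its reduced subwords without
right descents in `J`. In such a subword each white letter is followed by one with which it does not
commute. On a path of an acyclic graph this must be its successor, so the subword is a suffix
(`isSuffix_of_blocked`) and the elements below form a chain. Conversely (`exists_ofPath_of_mem_VX`),
remove the first letter `i` of an element of `VX`: by induction a white path is left. Putting `i`
back extends the path, or creates two elements of equal rank, or, by the braid relation of an
unlabelled edge, creates a right descent in `J`.

As for edges, `mu a b` recovers `m(a,b)`, because `X^0(a,b)` consists of the elements of the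
dihedral group of `a` and `b`. Coverings prolong a white path by one vertex. If `a` does not occur
in `w`, the candidates for two covers of `w` above `a` are `aw` and `wa`, which differ unless `a`
commutes with all letters of `w`; minimality puts the non-commuting letter at the start of the path.

The geometric representation supplies the orders of products and the independence of simple
reflections. Signed conjugation supplies strong exchange, hence the deletion and subword properties.
-/

namespace CoxeterMatrix

/-! ### The geometric representation and the orders of products of two reflections -/

open Real Module Polynomial.Chebyshev

variable {B : Type*} (M : CoxeterMatrix B)

/-- The linear form of the geometric representation attached to the vertex `i`: it maps the simple
root `j` to `-2 cos (π / m(i,j))`. For `m(i,j) = ∞`, encoded by `0`, this is `-2`. -/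
noncomputable def coroot (i : B) : Dual ℝ (B →₀ ℝ) :=
  Finsupp.linearCombination ℝ fun j => -2 * cos (π / M i j)

/-- The simple root attached to `i`. -/
noncomputable def root (i : B) : B →₀ ℝ := Finsupp.single i 1

theorem coroot_root (i j : B) : M.coroot i (root j) = -2 * cos (π / M i j) := by
  simp [coroot, root]

theorem coroot_root_self (i : B) : M.coroot i (root i) = 2 := by
  simp [coroot_root]

theorem coroot_root_ne_zero {i j : B} (h : M i j ≠ 2) : M.coroot i (root j) ≠ 0 := by
  rw [coroot_root]
  by_cases hij : i = j
  · subst hij; simp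
  have h1 := M.off_diagonal i j hij
  rcases Nat.eq_zero_or_pos (M i j) with h0 | h0
  · simp [h0]
  have h3 : (3 : ℝ) ≤ M i j := by exact_mod_cast (by omega : 3 ≤ M i j)
  have : 0 < cos (π / M i j) := by
    apply cos_pos_of_mem_Ioo
    have hp := pi_pos
    constructor
    · have : 0 < π / M i j := by positivity
      linarith
    · rw [div_lt_div_iff₀ (by linarith) (by norm_num)]
      nlinarith
  nlinarith

/-- The reflection of the geometric representation attached to the vertex `i`. -/
noncomputable def geomReflection (i : B) : (B →₀ ℝ) ≃ₗ[ℝ] (B →₀ ℝ) :=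
  reflection (M.coroot_root_self i)

theorem geomReflection_apply (i : B) (v : B →₀ ℝ) :
    M.geomReflection i v = v - M.coroot i v • root i := reflection_apply _ _

theorem coroot_root_mul (i j : B) :
    M.coroot i (root j) * M.coroot j (root i) - 2 = 2 * cos (2 * (π / M i j)) := by
  rw [coroot_root, coroot_root, M.symmetric j i, cos_two_mul]
  ring

/-- The bound `3 ≤ m` puts `2π/m` strictly between `0` and `π`, so the denominator is positive. For
`m = 2` it vanishes, and that case is treated apart in what follows. -/
theorem eval_S_eq {m : ℕ} (hm : 3 ≤ m) (n : ℤ) :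
    (S ℝ n).eval (2 * cos (2 * (π / m))) = sin ((n + 1) * (2 * (π / m))) / sin (2 * (π / m)) ∧
      sin (2 * (π / m)) ≠ 0 := by
  have hm' : (3 : ℝ) ≤ m := by exact_mod_cast hm
  have hpos : 0 < sin (2 * (π / m)) := by
    have hp := pi_pos
    apply sin_pos_of_pos_of_lt_pi
    · positivity
    · rw [← mul_div_assoc, div_lt_iff₀ (by linarith)]
      nlinarith
  refine ⟨?_, hpos.ne'⟩
  rw [eq_div_iff hpos.ne']
  exact S_two_mul_real_cos _ _

theorem geomReflection_mul_pow (i j : B) :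
    (M.geomReflection i * M.geomReflection j) ^ M i j = 1 := by
  by_cases hij : i = j
  · subst hij
    rw [M.diagonal, pow_one]
    exact LinearEquiv.ext (involutive_reflection (M.coroot_root_self i))
  have h1 := M.off_diagonal i j hij
  rcases Nat.eq_zero_or_pos (M i j) with h0 | h0
  · simp [h0]
  rcases (by omega : M i j = 2 ∨ 3 ≤ M i j) with h2 | h3
  · have e1 : M.coroot i (root j) = 0 := by rw [coroot_root, h2]; simp
    have e2 : M.coroot j (root i) = 0 := by rw [coroot_root, M.symmetric, h2]; simp
    have e3 := M.coroot_root_self i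
    have e4 := M.coroot_root_self j
    rw [h2, pow_two]
    apply LinearEquiv.ext
    intro v
    simp only [LinearEquiv.mul_apply, geomReflection_apply, map_sub, map_smul, e1, e2, e3, e4,
      LinearEquiv.coe_one, id]
    module
  · apply LinearEquiv.ext
    intro v
    have key := reflection_mul_reflection_pow_apply (M.coroot_root_self i) (M.coroot_root_self j)
      (M i j) v (2 * cos (2 * (π / M i j))) (M.coroot_root_mul i j).symm
    refine key.trans ?_
    have hm' : (M i j : ℝ) ≠ 0 := by positivity
    generalize M i j = m at h3 hm'
    -- Every correction to the identity carries the factor `S_{k-1}` if `m = 2k`, and `S_k +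
    -- S_{k-1}` if `m = 2k + 1`. Both vanish at `2 cos (2π/m)`.
    obtain ⟨k, rfl | rfl⟩ := Nat.even_or_odd' m
    · have d1 : (((2 * k : ℕ) : ℤ) - 2) / 2 = k - 1 := by omega
      have d2 : (((2 * k : ℕ) : ℤ) - 1) / 2 = k - 1 := by omega
      have z : (S ℝ ((k : ℤ) - 1)).eval (2 * cos (2 * (π / (2 * k : ℕ)))) = 0 := by
        rw [(eval_S_eq h3 _).1]
        have : (((k : ℤ) - 1 : ℤ) + 1 : ℝ) * (2 * (π / (2 * k : ℕ))) = π := by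
          push_cast at hm' ⊢
          have : (k : ℝ) ≠ 0 := fun h => hm' (by rw [h]; simp)
          field_simp
          ring
        rw [this]
        simp
      rw [d1, d2, z]
      simp
    · have d1 : (((2 * k + 1 : ℕ) : ℤ) - 2) / 2 = k - 1 := by omega
      have d2 : (((2 * k + 1 : ℕ) : ℤ) - 1) / 2 = k := by omega
      have d3 : (((2 * k + 1 : ℕ) : ℤ) - 3) / 2 = k - 1 := by omega
      have d4 : (((2 * k + 1 : ℕ) : ℤ)) / 2 = k := by omega
      have z : (S ℝ (k : ℤ)).eval (2 * cos (2 * (π / (2 * k + 1 : ℕ)))) +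
          (S ℝ ((k : ℤ) - 1)).eval (2 * cos (2 * (π / (2 * k + 1 : ℕ)))) = 0 := by
        rw [(eval_S_eq h3 _).1, (eval_S_eq h3 _).1, ← add_div]
        have : (((k : ℤ) : ℝ) + 1) * (2 * (π / (2 * k + 1 : ℕ))) =
            2 * π - (((k : ℤ) - 1 : ℤ) + 1 : ℝ) * (2 * (π / (2 * k + 1 : ℕ))) := by
          push_cast at hm' ⊢
          field_simp
          ring
        rw [this, sin_two_pi_sub]
        simp
      rw [d1, d2, d3, d4, z]
      simp

/-- Apply the `k`-th power to the root `i`. Its coordinate at `j` gives `S_{k-1} = 0`, then the one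
at `i` gives `S_k = 1`. With `θ = 2π/m` this says `sin kθ = 0` and `cos kθ = 1`. Separate cases are
`m = 2`, where an odd power negates the root, and `m = ∞`, where `S_{k-1}` is evaluated at `2` and
equals `k`. -/
theorem dvd_of_geomReflection_mul_pow {i j : B} (hij : i ≠ j) {k : ℕ}
    (h : (M.geomReflection i * M.geomReflection j) ^ k = 1) : M i j ∣ k := by
  have h1 := M.off_diagonal i j hij
  have key := reflection_mul_reflection_pow_apply_self (M.coroot_root_self i)
    (M.coroot_root_self j) k (2 * cos (2 * (π / M i j))) (M.coroot_root_mul i j).symm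
  change ((M.geomReflection i * M.geomReflection j) ^ k) _ = _ at key
  rw [h] at key
  have ki := DFunLike.congr_fun key i
  have kj := DFunLike.congr_fun key j
  simp only [root, LinearEquiv.coe_one, id, Finsupp.add_apply, Finsupp.smul_apply,
    Finsupp.single_eq_same, Finsupp.single_eq_of_ne hij, Finsupp.single_eq_of_ne hij.symm,
    smul_eq_mul, mul_one, mul_zero, add_zero, zero_add] at ki kj
  by_cases h2 : M i j = 2
  · rw [h2] at ki kj ⊢
    by_contra hk
    rw [← even_iff_two_dvd, Nat.not_even_iff_odd] at hk
    obtain ⟨n, rfl⟩ := hk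
    have e1 : M.coroot i (Finsupp.single j 1) = 0 := by
      have := M.coroot_root i j
      rw [h2] at this
      simpa [root] using this
    have e2 : M.coroot j (Finsupp.single i 1) = 0 := by
      have := M.coroot_root j i
      rw [M.symmetric, h2] at this
      simpa [root] using this
    have hsq : (M.geomReflection i * M.geomReflection j) ^ 2 = 1 := by
      have := M.geomReflection_mul_pow i j
      rwa [h2] at this
    rw [pow_succ, pow_mul, hsq, one_pow, one_mul] at h
    have := DFunLike.congr_fun (LinearEquiv.congr_fun h (root i)) i
    have e3 := M.coroot_root_self i
    simp only [LinearEquiv.mul_apply, geomReflection_apply, map_sub, map_smul, root, e1, e2,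
      LinearEquiv.coe_one, id] at this e3
    rw [e3] at this
    norm_num at this
  have hne : M.coroot j (root i) ≠ 0 := M.coroot_root_ne_zero (by rwa [M.symmetric])
  have hS : (S ℝ ((k : ℤ) - 1)).eval (2 * cos (2 * (π / M i j))) = 0 := by
    rcases mul_eq_zero.1 kj.symm with h | h
    · exact h
    · exact absurd (neg_eq_zero.1 h) hne
  rw [hS, add_zero] at ki
  rcases Nat.eq_zero_or_pos (M i j) with h0 | h0
  · rw [h0] at hS ⊢
    simp at hS
    simp [hS]
  have h3 : 3 ≤ M i j := by omega
  obtain ⟨e1, hs⟩ := eval_S_eq h3 ((k : ℤ) - 1)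
  obtain ⟨e2, -⟩ := eval_S_eq h3 (k : ℤ)
  rw [e1, div_eq_zero_iff, or_iff_left hs] at hS
  rw [e2, eq_div_iff hs, one_mul] at ki
  have hS' : sin (k * (2 * (π / M i j))) = 0 := by
    rw [← hS]; push_cast; ring_nf
  have hc : cos (k * (2 * (π / M i j))) = 1 := by
    have e : sin (2 * (π / M i j)) = cos (k * (2 * (π / M i j))) * sin (2 * (π / M i j)) := by
      nth_rewrite 1 [ki]
      push_cast
      rw [add_mul, one_mul, sin_add, hS']
      ring
    exact (mul_right_cancel₀ hs (by rw [one_mul]; exact e)).symm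
  obtain ⟨n, hn⟩ := (cos_eq_one_iff _).1 hc
  have hm' : (M i j : ℝ) ≠ 0 := by positivity
  have : (k : ℝ) = n * M i j := by
    have hp := pi_ne_zero
    field_simp at hn
    linarith
  have : (k : ℤ) = M i j * n := by
    rw [mul_comm]
    exact_mod_cast this
  exact Int.natCast_dvd_natCast.1 ⟨n, this⟩

end CoxeterMatrix

/-! ### Independence of the simple reflections -/

namespace CoxeterSystem

variable {B W : Type*} [Group W] {M : CoxeterMatrix B} (cs : CoxeterSystem M W)

open CoxeterMatrix

/-- The geometric representation. -/
noncomputable def geomRep : W →* ((B →₀ ℝ) ≃ₗ[ℝ] (B →₀ ℝ)) :=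
  cs.lift ⟨M.geomReflection, fun i j => M.geomReflection_mul_pow i j⟩

theorem geomRep_simple (i : B) : cs.geomRep (cs.simple i) = M.geomReflection i :=
  cs.lift_apply_simple _ i

theorem dvd_of_simple_mul_pow {i j : B} (hij : i ≠ j) {k : ℕ}
    (h : (cs.simple i * cs.simple j) ^ k = 1) : M i j ∣ k := by
  apply M.dvd_of_geomReflection_mul_pow hij
  rw [← cs.geomRep_simple, ← cs.geomRep_simple, ← map_mul, ← map_pow, h, map_one]

theorem simple_injective : Function.Injective cs.simple := by
  intro i j h
  by_contra hij
  have := cs.dvd_of_simple_mul_pow hij (k := 1) (by rw [h, pow_one, simple_mul_simple_self])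
  exact M.off_diagonal i j hij (Nat.dvd_one.1 this)

theorem commute_simple {i j : B} (h : M i j = 2) : Commute (cs.simple i) (cs.simple j) := by
  have := cs.simple_mul_simple_pow i j
  rw [h, pow_two] at this
  have h2 := mul_eq_one_iff_eq_inv.1 this
  rwa [mul_inv_rev, inv_simple, inv_simple] at h2

theorem commute_wordProd {i : B} {ω : List B} (h : ∀ j ∈ ω, M i j = 2) :
    Commute (cs.simple i) (cs.wordProd ω) := by
  induction ω with
  | nil => simp
  | cons j ω ih =>
    rw [wordProd_cons]
    exact (cs.commute_simple (h j (by simp))).mul_right (ih fun k hk => h k (by simp [hk]))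

theorem wordProd_mem_parabolic {K : Set B} {ω : List B} (h : ∀ i ∈ ω, i ∈ K) :
    cs.wordProd ω ∈ cs.parabolic K := by
  induction ω with
  | nil => simp
  | cons j ω ih =>
    rw [wordProd_cons]
    exact mul_mem (Subgroup.subset_closure ⟨j, h j (by simp), rfl⟩)
      (ih fun k hk => h k (by simp [hk]))

theorem exists_wordProd_of_mem_parabolic {K : Set B} {w : W} (h : w ∈ cs.parabolic K) :
    ∃ ω : List B, (∀ i ∈ ω, i ∈ K) ∧ w = cs.wordProd ω := by
  refine Subgroup.closure_induction (p := fun w _ => ∃ ω : List B, (∀ i ∈ ω, i ∈ K) ∧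
    w = cs.wordProd ω) ?_ ?_ ?_ ?_ h
  · rintro _ ⟨i, hi, rfl⟩
    exact ⟨[i], by simpa using hi, by simp⟩
  · exact ⟨[], by simp, by simp⟩
  · rintro _ _ _ _ ⟨ω, h1, rfl⟩ ⟨ω', h2, rfl⟩
    exact ⟨ω ++ ω', by simpa using fun i hi => hi.elim (h1 i) (h2 i), by rw [wordProd_append]⟩
  · rintro _ _ ⟨ω, h1, rfl⟩
    exact ⟨ω.reverse, by simpa using h1, by rw [wordProd_reverse]⟩

/-- The reflection attached to `j` changes only the coordinate at `j`. Since the simple reflection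
`i` negates the root `i`, this detects letters outside `K`. -/
theorem geomRep_apply_of_mem_parabolic {K : Set B} {w : W} (h : w ∈ cs.parabolic K) {i : B}
    (hi : i ∉ K) (v : B →₀ ℝ) : cs.geomRep w v i = v i := by
  obtain ⟨ω, hω, rfl⟩ := cs.exists_wordProd_of_mem_parabolic h
  clear h
  induction ω with
  | nil => simp
  | cons j ω ih =>
    have hj : i ≠ j := by
      rintro rfl
      exact hi (hω i (by simp))
    rw [wordProd_cons, map_mul, LinearEquiv.mul_apply, geomRep_simple, geomReflection_apply]
    simp [root, Finsupp.single_eq_of_ne hj, ih fun k hk => hω k (by simp [hk])]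

theorem mem_of_simple_mem_parabolic {K : Set B} {i : B} (h : cs.simple i ∈ cs.parabolic K) :
    i ∈ K := by
  by_contra hi
  have := cs.geomRep_apply_of_mem_parabolic h hi (root i)
  rw [geomRep_simple, geomReflection_apply, coroot_root_self] at this
  norm_num [root] at this

/-- The exchange property yields relations of this shape, in which the letter `i` must then occur.
-/
theorem mem_of_simple_eq_wordProd_mul {i : B} {ω ω' : List B}
    (h : cs.simple i = cs.wordProd ω * (cs.wordProd ω')⁻¹) : i ∈ ω ∨ i ∈ ω' := by
  apply cs.mem_of_simple_mem_parabolic (K := {j | j ∈ ω ∨ j ∈ ω'})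
  rw [h]
  exact mul_mem (cs.wordProd_mem_parabolic fun j hj => Or.inl hj)
    (inv_mem (cs.wordProd_mem_parabolic fun j hj => Or.inr hj))

/-- If the product of a word without repetitions commutes with a simple reflection which does not
occur in the word, then so do all its letters. -/
theorem eq_two_of_commute_wordProd {i : B} {ω : List B} (hω : ω.Nodup) (hi : i ∉ ω)
    (h : Commute (cs.simple i) (cs.wordProd ω)) : ∀ j ∈ ω, M i j = 2 := by
  -- As `w` commutes with the simple reflection `i`, the vector `w α_i` is negated by it and hence
  -- is a multiple of `α_i`.
  have hcoef : ∀ j, j ≠ i → cs.geomRep (cs.wordProd ω) (root i) j = 0 := by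
    intro j hj
    have h1 : M.geomReflection i (cs.geomRep (cs.wordProd ω) (root i)) =
        cs.geomRep (cs.wordProd ω) (M.geomReflection i (root i)) := by
      rw [← cs.geomRep_simple, ← LinearEquiv.mul_apply, ← map_mul, h.eq, map_mul,
        LinearEquiv.mul_apply]
    rw [M.geomReflection_apply i (root i), coroot_root_self, geomReflection_apply, map_sub,
      map_smul] at h1
    have h2 := DFunLike.congr_fun h1 j
    simp only [Finsupp.sub_apply, Finsupp.smul_apply, root, Finsupp.single_eq_of_ne hj,
      smul_eq_mul, mul_zero, sub_zero] at h2
    simp only [root]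
    linarith
  induction ω with
  | nil => simp
  | cons k ω ih =>
    rw [List.nodup_cons] at hω
    simp only [List.mem_cons, not_or] at hi
    have hk := hcoef k (Ne.symm hi.1)
    rw [wordProd_cons, map_mul, LinearEquiv.mul_apply, geomRep_simple, geomReflection_apply,
      Finsupp.sub_apply, cs.geomRep_apply_of_mem_parabolic (K := {j | j ∈ ω})
        (cs.wordProd_mem_parabolic fun j hj => hj) hω.1] at hk
    have hrest : ∀ j, j ≠ i → j ≠ k → cs.geomRep (cs.wordProd ω) (root i) j = 0 := by
      intro j hj hjk
      have := hcoef j hj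
      rw [wordProd_cons, map_mul, LinearEquiv.mul_apply, geomRep_simple, geomReflection_apply,
        Finsupp.sub_apply] at this
      simpa [root, Finsupp.single_eq_of_ne hjk] using this
    -- The tail leaves the coordinates at `i` and `k` alone, and `k` alters no coordinate but its
    -- own. So the tail already fixes `α_i`, and the coordinate at `k` of `w α_i` is, up to sign,
    -- the pairing of the coroot `k` with `α_i`, which must vanish.
    have hfix : cs.geomRep (cs.wordProd ω) (root i) = root i := by
      ext j
      by_cases hji : j = i
      · subst hji
        exact cs.geomRep_apply_of_mem_parabolic (K := {j | j ∈ ω})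
          (cs.wordProd_mem_parabolic fun j hj => hj) hi.2 _
      · by_cases hjk : j = k
        · subst hjk
          exact cs.geomRep_apply_of_mem_parabolic (K := {j | j ∈ ω})
            (cs.wordProd_mem_parabolic fun j hj => hj) hω.1 _
        · rw [hrest j hji hjk, root, Finsupp.single_eq_of_ne hji]
    have hki : M i k = 2 := by
      by_contra hne
      rw [hfix, root, Finsupp.single_eq_of_ne (Ne.symm hi.1)] at hk
      have := M.coroot_root_ne_zero (i := k) (j := i) (by rwa [M.symmetric])
      simp [root] at hk this
      exact this hk
    have hc : Commute (cs.simple i) (cs.wordProd ω) := by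
      rw [wordProd_cons] at h
      have := (cs.commute_simple hki).mul_right h
      rwa [← mul_assoc, simple_mul_simple_self, one_mul] at this
    have := ih hω.2 hi.2 hc fun j hj => by
      rw [hfix, root, Finsupp.single_eq_of_ne hj]
    simpa [hki] using this

end CoxeterSystem

namespace CoxeterSystem

variable {B W : Type*} [Group W] {M : CoxeterMatrix B} (cs : CoxeterSystem M W)

/-! ### The strong exchange property -/

open Classical in
/-- The involution of `W × ZMod 2` attached to a simple reflection: conjugation on the first
factor, and a change of sign at the simple reflection itself. -/
noncomputable def signedConj (i : B) : Equiv.Perm (W × ZMod 2) :=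
  Function.Involutive.toPerm
    (fun p => (cs.simple i * p.1 * cs.simple i, p.2 + if p.1 = cs.simple i then 1 else 0)) <| by
    rintro ⟨t, ε⟩
    have h : cs.simple i * t * cs.simple i = cs.simple i ↔ t = cs.simple i := by
      constructor
      · intro h
        have := congrArg (fun x => cs.simple i * (x * cs.simple i)) h
        simpa [mul_assoc] using this
      · rintro rfl
        simp
    simp only [h, Prod.mk.injEq]
    constructor
    · simp [mul_assoc]
    · rw [add_assoc, CharTwo.add_self_eq_zero, add_zero]

open Classical in
theorem signedConj_apply (i : B) (t : W) (ε : ZMod 2) : cs.signedConj i (t, ε) =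
    (cs.simple i * t * cs.simple i, ε + if t = cs.simple i then 1 else 0) := rfl

-- With `x` the product of `i` and `j`, the relation `x j x = j` shows that conjugation by `x`
-- shifts the elements `j x ^ l` by two steps. Each factor `x` thus contributes two more places
-- where the sign can change.
open Classical in
theorem signedConj_mul_pow_apply (i j : B) (n : ℕ) (t : W) (ε : ZMod 2) :
    ((cs.signedConj i * cs.signedConj j) ^ n) (t, ε) =
      ((cs.simple i * cs.simple j) ^ n * t * ((cs.simple i * cs.simple j) ^ n)⁻¹,
        ε + ∑ l ∈ Finset.range (2 * n),
          if t = cs.simple j * (cs.simple i * cs.simple j) ^ l then 1 else 0) := by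
  induction n generalizing t ε with
  | zero => simp
  | succ n ih =>
    rw [pow_succ, Equiv.Perm.mul_apply, Equiv.Perm.mul_apply, signedConj_apply, signedConj_apply,
      ih]
    set x := cs.simple i * cs.simple j with hx
    have hconj : cs.simple i * (cs.simple j * t * cs.simple j) * cs.simple i = x * t * x⁻¹ := by
      simp [hx, mul_assoc]
    have hxj : x * cs.simple j * x = cs.simple j := by
      simp [hx, mul_assoc]
    rw [hconj, show 2 * (n + 1) = 2 * n + 1 + 1 by ring, Finset.sum_range_succ',
      Finset.sum_range_succ']
    have e1 : (cs.simple j * t * cs.simple j = cs.simple i) ↔ t = cs.simple j * x ^ (0 + 1) := by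
      rw [zero_add, pow_one, hx]
      constructor
      · intro h
        have := congrArg (fun y => cs.simple j * (y * cs.simple j)) h
        simpa [mul_assoc] using this
      · rintro rfl
        simp [mul_assoc]
    have e2 : ∀ l, (x * t * x⁻¹ = cs.simple j * x ^ l) ↔ t = cs.simple j * x ^ (l + 1 + 1) := by
      intro l
      rw [mul_inv_eq_iff_eq_mul, mul_assoc (cs.simple j), ← pow_succ]
      constructor
      · intro h
        apply mul_left_cancel (a := x)
        rw [h, ← mul_assoc, pow_succ' _ (l + 1), ← mul_assoc, hxj]
      · rintro rfl
        rw [← mul_assoc, pow_succ' _ (l + 1), ← mul_assoc, hxj]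
    simp only [e1, e2, pow_zero, mul_one]
    refine Prod.ext ?_ ?_
    · simp [pow_succ, mul_assoc]
    · simp only
      ring

/-- As `x ^ m = 1`, the second half of the `2m` places repeats the first, and all sign changes
cancel modulo `2`. -/
theorem isLiftable_signedConj : M.IsLiftable cs.signedConj := by
  intro i j
  ext1 ⟨t, ε⟩
  classical
  rw [signedConj_mul_pow_apply, simple_mul_simple_pow, two_mul, Finset.sum_range_add]
  simp only [pow_add, simple_mul_simple_pow, one_mul, CharTwo.add_self_eq_zero]
  simp

/-- The action of `W` on `W × ZMod 2` by signed conjugation. -/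
noncomputable def signedConjHom : W →* Equiv.Perm (W × ZMod 2) :=
  cs.lift ⟨cs.signedConj, cs.isLiftable_signedConj⟩

theorem signedConjHom_simple (i : B) : cs.signedConjHom (cs.simple i) = cs.signedConj i :=
  cs.lift_apply_simple _ i

-- This makes the parity of the number of occurrences of `t` in the inversion sequence independent
-- of the word chosen for the element.
open Classical in
theorem signedConjHom_wordProd (ω : List B) (t : W) (ε : ZMod 2) :
    cs.signedConjHom (cs.wordProd ω) (t, ε) = (cs.wordProd ω * t * (cs.wordProd ω)⁻¹,
      ε + ((cs.rightInvSeq ω).count t : ℕ)) := by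
  induction ω with
  | nil => simp
  | cons i ω ih =>
    rw [wordProd_cons, map_mul, Equiv.Perm.mul_apply, ih]
    rw [signedConjHom_simple, signedConj_apply, rightInvSeq, List.count_cons]
    refine Prod.ext (by simp [mul_assoc]) ?_
    have : (cs.wordProd ω * t * (cs.wordProd ω)⁻¹ = cs.simple i) ↔
        (cs.wordProd ω)⁻¹ * cs.simple i * cs.wordProd ω = t := by
      rw [mul_inv_eq_iff_eq_mul, mul_assoc, inv_mul_eq_iff_eq_mul, eq_comm]
    simp only [this, beq_iff_eq]
    push_cast
    ring

theorem signedConjHom_apply (w t : W) (ε : ZMod 2) :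
    cs.signedConjHom w (t, ε) = (w * t * w⁻¹, ε + (cs.signedConjHom w (t, 0)).2) := by
  obtain ⟨ω, rfl⟩ := cs.wordProd_surjective w
  rw [signedConjHom_wordProd, signedConjHom_wordProd]
  simp

theorem signedConjHom_reflection {t : W} (ht : cs.IsReflection t) (ε : ZMod 2) :
    cs.signedConjHom t (t, ε) = (t, ε + 1) := by
  obtain ⟨u, i, rfl⟩ := ht
  have h1 : cs.signedConjHom u (cs.simple i, 0) = (u * cs.simple i * u⁻¹,
      (cs.signedConjHom u (cs.simple i, 0)).2) := by
    rw [signedConjHom_apply]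
  set a := (cs.signedConjHom u (cs.simple i, 0)).2 with ha
  have h2 : cs.signedConjHom u⁻¹ (u * cs.simple i * u⁻¹, ε) = (cs.simple i, ε - a) := by
    rw [map_inv, Equiv.Perm.inv_eq_iff_eq, signedConjHom_apply, ← ha]
    simp
  have h3 : cs.signedConjHom (cs.simple i) (cs.simple i, ε - a) = (cs.simple i, ε - a + 1) := by
    classical
    rw [signedConjHom_simple, signedConj_apply]
    simp
  rw [map_mul, map_mul, Equiv.Perm.mul_apply, Equiv.Perm.mul_apply, h2, h3, signedConjHom_apply,
    ← ha]
  refine Prod.ext rfl ?_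
  simp only
  ring

/-- If `t` does not occur, `w` keeps the sign at `t`. Since `t` flips its own sign, `wt` changes it,
so `t` occurs in the inversion sequence of a reduced word of `wt`. Then `w` would be shorter than
`wt`. -/
theorem mem_rightInvSeq_of_isRightInversion {ω : List B} {t : W}
    (h : cs.IsRightInversion (cs.wordProd ω) t) : t ∈ cs.rightInvSeq ω := by
  classical
  obtain ⟨ht, hlt⟩ := h
  by_contra hmem
  set w := cs.wordProd ω with hw
  have h0 : ∀ ε, cs.signedConjHom w (t, ε) = (w * t * w⁻¹, ε) := by
    intro ε
    rw [hw, signedConjHom_wordProd, List.count_eq_zero.2 hmem]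
    simp
  have h1 : cs.signedConjHom (w * t) (t, 0) = (w * t * w⁻¹, 1) := by
    rw [map_mul, Equiv.Perm.mul_apply, cs.signedConjHom_reflection ht, h0]
    simp
  obtain ⟨ω', hred, hω'⟩ := cs.exists_isReduced (w * t)
  rw [hω', signedConjHom_wordProd] at h1
  have hmem' : t ∈ cs.rightInvSeq ω' := by
    by_contra hn
    rw [List.count_eq_zero.2 hn] at h1
    simp at h1
  have := (cs.isRightInversion_of_mem_rightInvSeq hred hmem').2
  rw [← hω', mul_assoc, ht.mul_self, mul_one] at this
  omega

/-- The strong exchange property. -/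
theorem strong_exchange {ω : List B} {t : W} (ht : cs.IsReflection t)
    (h : cs.length (cs.wordProd ω * t) < cs.length (cs.wordProd ω)) :
    ∃ a i b, ω = a ++ i :: b ∧ cs.wordProd ω * t = cs.wordProd (a ++ b) := by
  obtain ⟨j, hj, rfl⟩ := List.mem_iff_getElem.1 (cs.mem_rightInvSeq_of_isRightInversion ⟨ht, h⟩)
  rw [length_rightInvSeq] at hj
  refine ⟨ω.take j, ω[j], ω.drop (j + 1), by simp, ?_⟩
  rw [← List.getD_eq_getElem _ 1, wordProd_mul_getD_rightInvSeq, List.eraseIdx_eq_take_drop_succ]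

theorem left_exchange {ω : List B} {i : B} (h : cs.IsLeftDescent (cs.wordProd ω) i) :
    ∃ a k b, ω = a ++ k :: b ∧ cs.simple i * cs.wordProd ω = cs.wordProd (a ++ b) := by
  have ht : cs.IsReflection ((cs.wordProd ω)⁻¹ * cs.simple i * cs.wordProd ω) :=
    ⟨(cs.wordProd ω)⁻¹, i, by simp⟩
  have e : cs.wordProd ω * ((cs.wordProd ω)⁻¹ * cs.simple i * cs.wordProd ω) =
      cs.simple i * cs.wordProd ω := by group
  have := cs.strong_exchange (ω := ω) ht (by rw [e]; exact h)
  rwa [e] at this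

/-- The deletion property. -/
theorem exists_isReduced_sublist (ω : List B) :
    ∃ ω' : List B, ω'.Sublist ω ∧ cs.IsReduced ω' ∧ cs.wordProd ω' = cs.wordProd ω := by
  induction ω with
  | nil => exact ⟨[], by simp, by simp [IsReduced], rfl⟩
  | cons i ω ih =>
    obtain ⟨ω', hsub, hred, he⟩ := ih
    by_cases hd : cs.IsLeftDescent (cs.wordProd ω') i
    · obtain ⟨a, k, b, rfl, hab⟩ := cs.left_exchange hd
      refine ⟨a ++ b, ?_, ?_, ?_⟩
      · refine (List.Sublist.trans ?_ hsub).trans (List.sublist_cons_self _ _)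
        simp
      · have h1 := cs.isLeftDescent_iff.1 hd
        rw [hab] at h1
        simp only [IsReduced, List.length_append, List.length_cons] at hred ⊢
        omega
      · rw [← hab, he, wordProd_cons]
    · refine ⟨i :: ω', hsub.cons_cons i, ?_, ?_⟩
      · have h1 := cs.not_isLeftDescent_iff.1 hd
        rw [IsReduced, wordProd_cons, h1, hred, List.length_cons]
      · rw [wordProd_cons, wordProd_cons, he]

/-! ### The subword property of the Bruhat order -/

/-- By strong exchange each downward step deletes one letter. The word need not be reduced, which
keeps the induction going. -/
theorem BruhatLE.exists_sublist {u w : W} (h : cs.BruhatLE u w) {ω : List B}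
    (hω : cs.wordProd ω = w) :
    ∃ ω' : List B, ω'.Sublist ω ∧ cs.IsReduced ω' ∧ cs.wordProd ω' = u := by
  induction h generalizing ω with
  | refl => subst hω; exact cs.exists_isReduced_sublist ω
  | @tail b c hb hstep ih =>
    obtain ⟨t, ht, rfl, hlt⟩ := hstep
    have e : cs.wordProd ω * t = b := by rw [hω, mul_assoc, ht.mul_self, mul_one]
    obtain ⟨x, i, y, rfl, hxy⟩ := cs.strong_exchange (ω := ω) ht (by rw [e, hω]; exact hlt)
    obtain ⟨ω', h1, h2, h3⟩ := ih (ω := x ++ y) (by rw [← hxy, e])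
    exact ⟨ω', h1.trans (by simp), h2, h3⟩

theorem bruhatLE_simple_mul {w : W} {i : B} (h : ¬ cs.IsLeftDescent w i) :
    cs.BruhatLE w (cs.simple i * w) := by
  refine Relation.ReflTransGen.single ⟨w⁻¹ * cs.simple i * w, ⟨w⁻¹, i, by simp⟩, by group, ?_⟩
  rw [cs.not_isLeftDescent_iff.1 h]
  omega

theorem simple_mul_bruhatLE {w : W} {i : B} (h : cs.IsLeftDescent w i) :
    cs.BruhatLE (cs.simple i * w) w := by
  simpa using cs.bruhatLE_simple_mul (cs.isLeftDescent_iff_not_isLeftDescent_mul.1 h)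

/-- The lifting property of the Bruhat order. -/
theorem BruhatLE.simple_mul {x y : W} (h : cs.BruhatLE x y) (i : B) :
    cs.BruhatLE (cs.simple i * x) y ∨ cs.BruhatLE (cs.simple i * x) (cs.simple i * y) := by
  induction h using Relation.ReflTransGen.head_induction_on with
  | refl => exact Or.inr Relation.ReflTransGen.refl
  | @head x z hstep hzy ih =>
    have key : cs.BruhatLE (cs.simple i * x) z ∨
        cs.BruhatLE (cs.simple i * x) (cs.simple i * z) := by
      by_cases hd : cs.IsLeftDescent x i
      · exact Or.inl ((cs.simple_mul_bruhatLE hd).trans (Relation.ReflTransGen.single hstep))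
      obtain ⟨t, ht, rfl, hlt⟩ := hstep
      by_cases hlt' : cs.length (cs.simple i * x) < cs.length (cs.simple i * (x * t))
      · exact Or.inr (Relation.ReflTransGen.single ⟨t, ht, (mul_assoc _ _ _).symm, hlt'⟩)
      obtain ⟨ω, hred, rfl⟩ := cs.exists_isReduced x
      have hne := ht.length_mul_left_ne (cs.simple i * cs.wordProd ω)
      rw [mul_assoc] at hne
      -- Here `ixt` is shorter than `ix`, so a letter of `i :: ω` is deleted. If it is `i`, then `xt
      -- = ix`. If it lies in `ω`, then `xt` is shorter than `x`, a contradiction.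
      obtain ⟨a, k, b, hab, he⟩ := cs.strong_exchange (ω := i :: ω) ht (by
        rw [wordProd_cons, mul_assoc]; omega)
      rw [wordProd_cons, mul_assoc] at he
      left
      rcases a with _ | ⟨i', a⟩
      · simp only [List.nil_append, List.cons.injEq] at hab he
        obtain ⟨rfl, rfl⟩ := hab
        have hz : cs.simple i * cs.wordProd ω = cs.wordProd ω * t := by
          simpa only [simple_mul_simple_cancel_left] using (congrArg (cs.simple i * ·) he).symm
        rw [hz]
        exact Relation.ReflTransGen.refl
      · exfalso
        simp only [List.cons_append, List.cons.injEq] at hab he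
        obtain ⟨rfl, rfl⟩ := hab
        rw [wordProd_cons, mul_left_cancel_iff] at he
        rw [he, hred.eq] at hlt
        have := cs.length_wordProd_le (a ++ b)
        simp only [List.length_append, List.length_cons] at this hlt
        omega
    rcases key with h1 | h1
    · exact Or.inl (h1.trans hzy)
    · exact ih.imp h1.trans h1.trans

theorem IsReduced.of_cons {cs : CoxeterSystem M W} {i : B} {ω : List B}
    (h : cs.IsReduced (i :: ω)) : cs.IsReduced ω := h.drop 1

theorem IsReduced.not_isLeftDescent {cs : CoxeterSystem M W} {i : B} {ω : List B}
    (h : cs.IsReduced (i :: ω)) : ¬ cs.IsLeftDescent (cs.wordProd ω) i := by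
  rw [not_isLeftDescent_iff, ← wordProd_cons, h.eq, h.of_cons.eq, List.length_cons]

/-- Restoring the letters from the left, the lifting property handles a letter kept in both words.
-/
theorem bruhatLE_of_sublist {ω ω' : List B} (hω : cs.IsReduced ω) (h : ω'.Sublist ω) :
    cs.BruhatLE (cs.wordProd ω') (cs.wordProd ω) := by
  induction h with
  | slnil => exact Relation.ReflTransGen.refl
  | cons i h ih =>
    rw [wordProd_cons]
    exact (ih hω.of_cons).trans (cs.bruhatLE_simple_mul hω.not_isLeftDescent)
  | cons_cons i h ih =>
    rw [wordProd_cons, wordProd_cons]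
    rcases (ih hω.of_cons).simple_mul _ i with h | h
    · exact h.trans (cs.bruhatLE_simple_mul hω.not_isLeftDescent)
    · exact h

/-! ### Shortest coset representatives -/

/-- The shortest representatives of `W / W_J` are the elements without right descents in `J`. -/
theorem forall_length_le_iff {J : Set B} {w : W} :
    (∀ u ∈ cs.parabolic J, cs.length w ≤ cs.length (w * u)) ↔
      ∀ i ∈ J, ¬ cs.IsRightDescent w i := by
  constructor
  · intro h i hi hd
    exact absurd (h _ (Subgroup.subset_closure ⟨i, hi, rfl⟩)) (not_le.2 hd)
  intro h
  -- Write `w` as a shortest element of its coset followed by a reduced word `η` in `J`. If `η` is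
  -- not empty, its last letter will be a right descent of `w`.
  obtain ⟨⟨u, hu⟩, hmin⟩ : ∃ u : cs.parabolic J, ∀ u' : cs.parabolic J,
      cs.length (w * u.1) ≤ cs.length (w * u'.1) := by
    obtain ⟨u, -, hu⟩ := (measure fun u : cs.parabolic J => cs.length (w * u.1)).wf.has_min
      Set.univ ⟨1, trivial⟩
    exact ⟨u, fun u' => not_lt.1 (hu u' trivial)⟩
  obtain ⟨η₀, hη₀, hu'⟩ := cs.exists_wordProd_of_mem_parabolic (inv_mem hu)
  obtain ⟨ω, hω, hv⟩ := cs.exists_isReduced (w * u)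
  obtain ⟨η, hsub, hred, he⟩ := cs.exists_isReduced_sublist η₀
  have hη : ∀ i ∈ η, i ∈ J := fun i hi => hη₀ i (hsub.subset hi)
  have hw : w = cs.wordProd (ω ++ η) := by
    rw [wordProd_append, ← hv, he, ← hu']
    group
  -- A reduced subword `a ++ b` with the same product has `a` in the same coset, so minimality
  -- forces `a = ω`. Then `b` has the product of the reduced word `η` and equals it.
  have hredw : cs.IsReduced (ω ++ η) := by
    obtain ⟨ζ, hζ, hζred, hζe⟩ := cs.exists_isReduced_sublist (ω ++ η)
    obtain ⟨a, b, rfl, ha, hb⟩ := List.sublist_append_iff.1 hζ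
    have hab : cs.wordProd a = w * (cs.wordProd b)⁻¹ := by
      rw [hw, ← hζe, wordProd_append]
      group
    have hbJ : (cs.wordProd b)⁻¹ ∈ cs.parabolic J :=
      inv_mem (cs.wordProd_mem_parabolic fun i hi => hη i (hb.subset hi))
    have h1 := hmin ⟨_, hbJ⟩
    rw [← hab, hv, hω.eq] at h1
    obtain rfl := ha.eq_of_length_le (h1.trans (cs.length_wordProd_le a))
    rw [wordProd_append, wordProd_append, mul_left_cancel_iff] at hζe
    have h2 := cs.length_wordProd_le b
    rw [hζe, hred.eq] at h2
    obtain rfl := hb.eq_of_length_le h2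
    exact hζred
  rcases η.eq_nil_or_concat with rfl | ⟨η', i, rfl⟩
  · intro u' hu'
    rw [List.append_nil] at hw
    have := hmin ⟨u * u', mul_mem hu hu'⟩
    rwa [hv, ← mul_assoc, hv, ← hw] at this
  · refine absurd ?_ (h i (hη i (by simp)))
    rw [IsRightDescent, hw, hredw.eq, List.concat_eq_append, ← List.append_assoc, wordProd_append,
      wordProd_singleton, simple_mul_simple_cancel_right]
    have := cs.length_wordProd_le (ω ++ η')
    rw [List.length_append (bs := [i]), List.length_singleton]
    omega

end CoxeterSystem

/-! ### Paths in acyclic graphs -/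

namespace SimpleGraph

variable {V : Type*} {G : SimpleGraph V}

/-- Paths as lists of vertices. -/
def IsPathList (G : SimpleGraph V) (l : List V) : Prop := l.IsChain G.Adj ∧ l.Nodup

theorem IsPathList.of_append_left {l l' : List V} (h : G.IsPathList (l ++ l')) :
    G.IsPathList l := ⟨h.1.left_of_append, h.2.of_append_left⟩

theorem IsPathList.of_append_right {l l' : List V} (h : G.IsPathList (l ++ l')) :
    G.IsPathList l' := ⟨h.1.right_of_append, h.2.of_append_right⟩

theorem IsPathList.of_cons {x : V} {l : List V} (h : G.IsPathList (x :: l)) : G.IsPathList l :=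
  ⟨h.1.of_cons, h.2.of_cons⟩

theorem IsPathList.reverse {l : List V} (h : G.IsPathList l) : G.IsPathList l.reverse := by
  refine ⟨?_, List.nodup_reverse.2 h.2⟩
  rw [List.isChain_reverse]
  exact h.1.imp fun _ _ h => h.symm

theorem IsAcyclic.pathList_unique (hG : G.IsAcyclic) {l l' : List V} (h : G.IsPathList l)
    (h' : G.IsPathList l') (hne : l ≠ []) (hne' : l' ≠ []) (hhead : l.head hne = l'.head hne')
    (hlast : l.getLast hne = l'.getLast hne') : l = l' := by
  let p := Walk.ofSupport l hne h.1
  let q := (Walk.ofSupport l' hne' h'.1).copy hhead.symm hlast.symm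
  have hp : p.IsPath := by
    rw [Walk.isPath_def, Walk.support_ofSupport]
    exact h.2
  have hq : q.IsPath := by
    rw [Walk.isPath_def, Walk.support_copy, Walk.support_ofSupport]
    exact h'.2
  have := congrArg (fun r : G.Path _ _ => r.1.support) 
    ((hG.subsingleton_path _ _).elim ⟨p, hp⟩ ⟨q, hq⟩)
  simpa [p, q, Walk.support_ofSupport] using this

/-- Otherwise the edge from `v` to `q` and the detour through `p` along the path would be two
different paths. -/
theorem IsAcyclic.eq_of_adj_of_adj (hG : G.IsAcyclic) {v p q : V} {l : List V}
    (h : G.IsPathList l) (hv : v ∉ l) (hp : p ∈ l) (hq : q ∈ l) (hvp : G.Adj v p)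
    (hvq : G.Adj v q) : p = q := by
  by_contra hpq
  obtain ⟨a, b, rfl⟩ := List.append_of_mem hp
  rw [List.mem_append, List.mem_cons] at hq
  have key : ∀ (c : List V) (p q : V), v ∉ p :: c → q ∈ c → G.IsPathList (p :: c) → G.Adj v p →
      G.Adj v q → False := by
    intro c p q hv hq hc hvp hvq
    obtain ⟨c1, c2, rfl⟩ := List.append_of_mem hq
    have h1 : G.IsPathList (v :: p :: c1 ++ [q]) := by
      have : G.IsPathList (p :: (c1 ++ [q])) := by
        have h2 : p :: (c1 ++ q :: c2) = (p :: (c1 ++ [q])) ++ c2 := by simp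
        rw [h2] at hc
        exact hc.of_append_left
      refine ⟨List.IsChain.cons_cons hvp this.1, List.nodup_cons.2 ⟨?_, this.2⟩⟩
      simp only [List.mem_cons, List.mem_append, not_or] at hv ⊢
      simp [hv.1, hv.2]
    have h2 : G.IsPathList [v, q] := by
      refine ⟨by simpa using hvq, by simpa using hvq.ne⟩
    have := hG.pathList_unique h1 h2 (by simp) (by simp) rfl (by simp)
    simpa using congrArg List.length this
  rcases hq with hq | hq | hq
  · have h' := h.reverse
    rw [List.reverse_append, List.reverse_cons, List.append_assoc] at h'
    refine key a.reverse p q ?_ (by simpa using hq) h'.of_append_right hvp hvq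
    simp only [List.mem_append, List.mem_cons, not_or] at hv
    simp [hv.1, hv.2.1]
  · exact hpq hq.symm
  · refine key b p q ?_ hq h.of_append_right hvp hvq
    simp only [List.mem_append, not_or] at hv
    exact hv.2

theorem IsAcyclic.eq_head_of_adj (hG : G.IsAcyclic) {x y z : V} {l : List V}
    (h : G.IsPathList (x :: z :: l)) (hy : y ∈ z :: l) (hxy : G.Adj x y) : y = z :=
  hG.eq_of_adj_of_adj h.of_cons (List.nodup_cons.1 h.2).1 hy (by simp) hxy
    (List.isChain_cons_cons.1 h.1).1

end SimpleGraph

namespace CoxeterSystem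

variable {B W : Type*} [Group W] {M : CoxeterMatrix B} (cs : CoxeterSystem M W)

theorem right_exchange {ω : List B} {i : B} (h : cs.IsRightDescent (cs.wordProd ω) i) :
    ∃ a k b, ω = a ++ k :: b ∧ cs.wordProd ω * cs.simple i = cs.wordProd (a ++ b) :=
  cs.strong_exchange (cs.isReflection_simple i) h

/-! ### Words without repetitions -/

/-- A failure would, by exchange, write a simple reflection through letters different from it. -/
theorem isReduced_of_nodup {ω : List B} (h : ω.Nodup) : cs.IsReduced ω := by
  induction ω with
  | nil => simp [IsReduced]
  | cons i ω ih =>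
    rw [List.nodup_cons] at h
    have hd : ¬ cs.IsLeftDescent (cs.wordProd ω) i := by
      intro hd
      obtain ⟨a, k, b, rfl, he⟩ := cs.left_exchange hd
      rw [← eq_mul_inv_iff_mul_eq] at he
      rcases cs.mem_of_simple_eq_wordProd_mul he with h1 | h1
      · exact h.1 (by simp at h1 ⊢; tauto)
      · exact h.1 h1
    rw [IsReduced, wordProd_cons, cs.not_isLeftDescent_iff.1 hd, (ih h.2).eq, List.length_cons]

variable (M) in
/-- Every letter in `J` of the word is followed by a letter (not necessarily at once) with which
it does not commute. -/
def Blocked (J : Set B) : List B → Prop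
  | [] => True
  | i :: ω => (i ∈ J → ∃ j ∈ ω, M i j ≠ 2) ∧ Blocked J ω

/-- Removing the first letter of a reduced word therefore does not lead out of `W^J`. This is what
the inductions on words rest on. -/
theorem not_isRightDescent_of_cons {i j : B} {ω : List B} (hω : cs.IsReduced (i :: ω))
    (h : ¬ cs.IsRightDescent (cs.wordProd (i :: ω)) j) :
    ¬ cs.IsRightDescent (cs.wordProd ω) j := by
  intro hd
  apply h
  unfold IsRightDescent at hd ⊢
  rw [hω.eq, wordProd_cons, mul_assoc]
  rw [hω.of_cons.eq] at hd
  have := cs.length_mul_le (cs.simple i) (cs.wordProd ω * cs.simple j)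
  rw [length_simple] at this
  rw [List.length_cons]
  omega

theorem isRightDescent_of_commute {i : B} {a b : List B} (hω : cs.IsReduced (a ++ i :: b))
    (h : ∀ j ∈ b, M i j = 2) : cs.IsRightDescent (cs.wordProd (a ++ i :: b)) i := by
  have : cs.wordProd (a ++ i :: b) * cs.simple i = cs.wordProd (a ++ b) := by
    rw [wordProd_append, wordProd_cons, (cs.commute_wordProd h).eq, wordProd_append]
    simp [mul_assoc]
  rw [IsRightDescent, this, hω.eq]
  have := cs.length_wordProd_le (a ++ b)
  simp only [List.length_append, List.length_cons] at this ⊢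
  omega

/-- Exchange deletes a letter. If it lies in the tail, the tail has a descent already. If it is the
first letter, independence identifies that letter with `i`, which then commutes with the tail and
hence with each letter of it, against blockedness. -/
theorem not_isRightDescent_of_blocked {J : Set B} {ω : List B} (hω : ω.Nodup)
    (h : Blocked M J ω) : ∀ i ∈ J, ¬ cs.IsRightDescent (cs.wordProd ω) i := by
  induction ω with
  | nil => intro i _; simpa using cs.not_isRightDescent_one i
  | cons x ω ih =>
    intro i hi hd
    obtain ⟨hx, hω'⟩ := List.nodup_cons.1 hω
    obtain ⟨hb, hblocked⟩ := h
    have hih := ih hω' hblocked i hi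
    obtain ⟨a, k, b, hab, he⟩ := cs.right_exchange hd
    rw [wordProd_cons, mul_assoc] at he
    rcases a with _ | ⟨x', a⟩
    · simp only [List.nil_append, List.cons.injEq] at hab he
      obtain ⟨rfl, rfl⟩ := hab
      have hix : i = x := by
        have h1 : cs.simple x = cs.wordProd ω * (cs.wordProd (ω ++ [i]))⁻¹ := by
          rw [wordProd_append, wordProd_singleton, eq_mul_inv_iff_mul_eq]
          exact he
        rcases cs.mem_of_simple_eq_wordProd_mul h1 with h2 | h2
        · exact absurd h2 hx
        · simp only [List.mem_append, hx, List.mem_singleton, false_or] at h2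
          exact h2.symm
      subst hix
      have hc : Commute (cs.simple i) (cs.wordProd ω) := by
        have := congrArg (· * cs.simple i) he
        change _ = _
        simpa [mul_assoc] using this
      obtain ⟨j, hj, hne⟩ := hb hi
      exact hne (cs.eq_two_of_commute_wordProd hω' hx hc j hj)
    · simp only [List.cons_append, List.cons.injEq] at hab he
      obtain ⟨rfl, rfl⟩ := hab
      rw [wordProd_cons, mul_left_cancel_iff] at he
      apply hih
      rw [IsRightDescent, he, (cs.isReduced_of_nodup hω').eq]
      have := cs.length_wordProd_le (a ++ b)
      simp only [List.length_append, List.length_cons] at this ⊢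
      omega

theorem blocked_of_not_isRightDescent {J : Set B} {ω : List B} (hω : cs.IsReduced ω)
    (h : ∀ i ∈ J, ¬ cs.IsRightDescent (cs.wordProd ω) i) : Blocked M J ω := by
  induction ω with
  | nil => trivial
  | cons x ω ih =>
    refine ⟨fun hx => ?_, ih hω.of_cons fun i hi => cs.not_isRightDescent_of_cons hω (h i hi)⟩
    by_contra! hc
    exact h x hx (cs.isRightDescent_of_commute (a := []) hω hc)

/-! ### The poset of shortest coset representatives -/

namespace ShortestRep

open PointedPoset

variable {cs} {J : Set B}

/-- The shortest representative given by a word without right descents in `J`. -/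
def ofWord (cs : CoxeterSystem M W) (ω : List B)
    (h : ∀ i ∈ J, ¬ cs.IsRightDescent (cs.wordProd ω) i) : cs.ShortestRep J :=
  ⟨cs.wordProd ω, cs.forall_length_le_iff.2 h⟩

theorem not_isRightDescent (x : cs.ShortestRep J) : ∀ i ∈ J, ¬ cs.IsRightDescent x.1 i :=
  cs.forall_length_le_iff.1 x.2

theorem le_iff {x y : cs.ShortestRep J} : x ≤ y ↔ cs.BruhatLE x.1 y.1 := Iff.rfl

theorem length_lt {x y : cs.ShortestRep J} (h : x < y) : cs.length x.1 < cs.length y.1 := by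
  rcases (le_iff.1 h.le).length_lt_or_eq with h1 | h1
  · exact absurd (Subtype.ext h1) h.ne
  · exact h1

theorem length_le {x y : cs.ShortestRep J} (h : x ≤ y) : cs.length x.1 ≤ cs.length y.1 := by
  rcases h.eq_or_lt with rfl | h
  · rfl
  · exact (length_lt h).le

theorem covBy_of_length {x y : cs.ShortestRep J} (h : x ≤ y)
    (h' : cs.length y.1 = cs.length x.1 + 1) : x ⋖ y := by
  refine ⟨lt_of_le_of_ne h ?_, fun z hz hz' => ?_⟩
  · rintro rfl
    omega
  · have := length_lt hz
    have := length_lt hz'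
    omega

theorem exists_word (x : cs.ShortestRep J) :
    ∃ ω, cs.IsReduced ω ∧ ∃ h, x = ofWord cs ω h := by
  obtain ⟨ω, hω, he⟩ := cs.exists_isReduced x.1
  exact ⟨ω, hω, by rw [← he]; exact x.not_isRightDescent, Subtype.ext he⟩

/-- Removing first letters of a reduced word gives a chain in `W^J` that meets every smaller length.
-/
theorem height_eq (x : cs.ShortestRep J) : Order.height x = cs.length x.1 := by
  have key : ∀ n : ℕ, ∀ x : cs.ShortestRep J, cs.length x.1 = n → Order.height x = n := by
    intro n
    induction n using Nat.strong_induction_on with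
    | _ n ih =>
      intro x hx
      apply le_antisymm
      · refine Order.height_le_coe_iff.2 fun y hy => ?_
        have hlt := length_lt hy
        rw [ih _ (hx ▸ hlt) y rfl]
        exact_mod_cast hx ▸ hlt
      · obtain ⟨ω, hω, h, rfl⟩ := x.exists_word
        rcases ω with _ | ⟨i, ω⟩
        · simp [ofWord] at hx
          simp [← hx]
        · have h' : ∀ j ∈ J, ¬ cs.IsRightDescent (cs.wordProd ω) j := fun j hj =>
            cs.not_isRightDescent_of_cons hω (h j hj)
          have hlt : ofWord cs ω h' < ofWord cs (i :: ω) h := by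
            refine lt_of_le_of_ne (cs.bruhatLE_of_sublist hω (List.sublist_cons_self _ _)) ?_
            intro he
            have := congrArg (fun z => cs.length z.1) he
            simp only [ofWord, hω.eq, hω.of_cons.eq, List.length_cons] at this
            omega
          have hn : n = ω.length + 1 := by rw [← hx]; exact hω.eq
          have := Order.height_add_one_le hlt
          rw [ih ω.length (by omega) _ hω.of_cons.eq] at this
          rw [hn]
          exact_mod_cast this
  exact key _ x rfl

theorem mem_layer {x : cs.ShortestRep J} {n : ℕ} :
    x ∈ layer (cs.ShortestRep J) n ↔ cs.length x.1 = n := by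
  rw [layer, Set.mem_ofPred_eq, height_eq, Nat.cast_inj]

theorem ofWord_le {ω ω' : List B} {h h'} (hω : cs.IsReduced ω) (hs : ω'.Sublist ω) :
    ofWord (J := J) cs ω' h' ≤ ofWord cs ω h := cs.bruhatLE_of_sublist hω hs

theorem exists_sublist {x : cs.ShortestRep J} {ω : List B} {h} (hx : x ≤ ofWord cs ω h) :
    ∃ ω' : List B, ω'.Sublist ω ∧ cs.IsReduced ω' ∧ ∃ h', x = ofWord cs ω' h' := by
  obtain ⟨ω', h1, h2, h3⟩ := (le_iff.1 hx).exists_sublist cs rfl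
  exact ⟨ω', h1, h2, by rw [h3]; exact x.not_isRightDescent, Subtype.ext h3.symm⟩

end ShortestRep

end CoxeterSystem

/-! ### White paths and the set `VX` -/

namespace CoxeterSystem

variable {B W : Type*} [Group W] {M : CoxeterMatrix B} (cs : CoxeterSystem M W)

open PointedPoset

variable (M) in
/-- The vertices of a path of the Coxeter graph which has its last vertex outside of `J` and all
its other vertices in `J`. -/
def IsWhitePath (J : Set B) (l : List B) : Prop :=
  M.coxeterGraph.IsPathList l ∧ ∃ m s, l = m ++ [s] ∧ s ∉ J ∧ ∀ i ∈ m, i ∈ J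

variable {J : Set B}

theorem IsWhitePath.ne_nil {l : List B} (h : IsWhitePath M J l) : l ≠ [] := by
  obtain ⟨-, m, s, rfl, -⟩ := h
  simp

theorem isWhitePath_singleton {s : B} (hs : s ∉ J) : IsWhitePath M J [s] :=
  ⟨⟨by simp, by simp⟩, [], s, rfl, hs, by simp⟩

theorem isWhitePath_singleton_iff {s : B} : IsWhitePath M J [s] ↔ s ∉ J := by
  refine ⟨?_, isWhitePath_singleton⟩
  rintro ⟨-, m, s', h, hs, -⟩
  rcases m with _ | ⟨_, m⟩
  · simp at h
    rwa [h]
  · simp at h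

theorem isWhitePath_cons_cons {i j : B} {l : List B} : IsWhitePath M J (i :: j :: l) ↔
    i ∈ J ∧ i ∉ j :: l ∧ M.coxeterGraph.Adj i j ∧ IsWhitePath M J (j :: l) := by
  constructor
  · rintro ⟨hp, m, s, he, hs, hm⟩
    rcases m with _ | ⟨k, m⟩
    · simp at he
    · simp only [List.cons_append, List.cons.injEq] at he
      obtain ⟨rfl, he⟩ := he
      exact ⟨hm _ (by simp), (List.nodup_cons.1 hp.2).1, (List.isChain_cons_cons.1 hp.1).1,
        hp.of_cons, m, s, he, hs, fun i hi => hm i (by simp [hi])⟩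
  · rintro ⟨hi, hnot, hadj, hp, m, s, he, hs, hm⟩
    refine ⟨⟨List.IsChain.cons_cons hadj hp.1, List.nodup_cons.2 ⟨hnot, hp.2⟩⟩, i :: m, s, ?_, hs,
      ?_⟩
    · rw [he]; rfl
    · simpa [hi] using hm

theorem IsWhitePath.of_append {a l : List B} (h : IsWhitePath M J (a ++ l)) (hl : l ≠ []) :
    IsWhitePath M J l := by
  induction a with
  | nil => exact h
  | cons i a ih =>
    rcases hal : a ++ l with _ | ⟨j, b⟩
    · simp [hl] at hal
    · rw [List.cons_append, hal, isWhitePath_cons_cons] at h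
      apply ih
      rw [hal]
      exact h.2.2.2

theorem IsWhitePath.of_isSuffix {l l' : List B} (h : IsWhitePath M J l) (hs : l' <:+ l)
    (hl : l' ≠ []) : IsWhitePath M J l' := by
  obtain ⟨a, rfl⟩ := hs
  exact h.of_append hl

/-- The set `K` is arbitrary: with a singleton it shows that a path has no right descent except its
last vertex. -/
theorem blocked_of_isChain {m : List B} {s : B} (h : (m ++ [s]).IsChain M.coxeterGraph.Adj)
    {K : Set B} (hs : s ∉ K) : Blocked M K (m ++ [s]) := by
  induction m with
  | nil => exact ⟨fun h => absurd h hs, trivial⟩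
  | cons i m ih =>
    refine ⟨fun _ => ?_, ih h.of_cons⟩
    rcases m with _ | ⟨j, m⟩
    · exact ⟨s, by simp, (List.isChain_cons_cons.1 h).1.2⟩
    · exact ⟨j, by simp, (List.isChain_cons_cons.1 h).1.2⟩

theorem IsWhitePath.not_isRightDescent {l : List B} (h : IsWhitePath M J l) :
    ∀ i ∈ J, ¬ cs.IsRightDescent (cs.wordProd l) i := by
  obtain ⟨hp, m, s, rfl, hs, -⟩ := h
  exact cs.not_isRightDescent_of_blocked hp.2 (blocked_of_isChain hp.1 hs)

/-- The shortest representative given by a white path. -/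
def ShortestRep.ofPath {l : List B} (h : IsWhitePath M J l) : cs.ShortestRep J :=
  ShortestRep.ofWord cs l (h.not_isRightDescent cs)

theorem IsWhitePath.isReduced {l : List B} (h : IsWhitePath M J l) : cs.IsReduced l :=
  cs.isReduced_of_nodup h.1.2

theorem length_ofPath {l : List B} (h : IsWhitePath M J l) :
    cs.length (ShortestRep.ofPath cs h).1 = l.length := h.isReduced cs

/-- If the first vertex is kept and is not the end of the path, it is white and needs a later
neighbour in the subword. Its only neighbour further along the path is the next vertex, so the rest
of the subword, a suffix by induction, is the whole tail. -/
theorem isSuffix_of_blocked (hG : M.coxeterGraph.IsAcyclic) {l l' : List B}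
    (h : IsWhitePath M J l) (hs : l'.Sublist l) (hb : Blocked M J l') : l' <:+ l := by
  induction l generalizing l' with
  | nil => exact absurd rfl h.ne_nil
  | cons i l ih =>
    rcases l with _ | ⟨j, l⟩
    · rcases List.sublist_singleton.1 hs with rfl | rfl
      · exact List.nil_suffix
      · exact List.suffix_refl _
    obtain ⟨hi, hil, hadj, hl⟩ := isWhitePath_cons_cons.1 h
    rcases List.sublist_cons_iff.1 hs with hs | ⟨r, rfl, hr⟩
    · exact (ih hl hs hb).trans (List.suffix_cons _ _)
    · obtain ⟨⟨k, hk, hik⟩, hb'⟩ := And.imp_left (· hi) hb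
      have hsuf := ih hl hr hb'
      have hkj : k = j := hG.eq_head_of_adj h.1 (hr.subset hk)
        ⟨fun e => hil (e ▸ hr.subset hk), hik⟩
      subst hkj
      obtain ⟨a, ha⟩ := hsuf
      rcases a with _ | ⟨k', a⟩
      · rw [List.nil_append] at ha
        rw [ha]
      · simp only [List.cons_append, List.cons.injEq] at ha
        obtain ⟨rfl, rfl⟩ := ha
        exact absurd (List.mem_append_right _ hk) (List.nodup_cons.1 hl.1.2).1

theorem exists_isSuffix_of_le (hG : M.coxeterGraph.IsAcyclic) {l : List B}
    (h : IsWhitePath M J l) {x : cs.ShortestRep J} (hx : x ≤ ShortestRep.ofPath cs h) :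
    ∃ l' : List B, l' <:+ l ∧ ∃ h', x = ShortestRep.ofWord cs l' h' := by
  obtain ⟨l', hs, hred, h', rfl⟩ := ShortestRep.exists_sublist hx
  exact ⟨l', isSuffix_of_blocked hG h hs (cs.blocked_of_not_isRightDescent hred h'), h', rfl⟩

theorem IsWhitePath.isReduced_of_isSuffix {l l' : List B} (h : IsWhitePath M J l)
    (hs : l' <:+ l) : cs.IsReduced l' :=
  cs.isReduced_of_nodup (h.1.2.sublist hs.sublist)

theorem mem_VX_iff {x : cs.ShortestRep J} : x ∈ VX (cs.ShortestRep J) ↔ 0 < cs.length x.1 ∧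
    ∀ y z, y ≤ x → z ≤ x → cs.length y.1 = cs.length z.1 → y = z := by
  simp only [VX, Set.mem_ofPred_eq, ShortestRep.mem_layer]
  constructor
  · rintro ⟨⟨i, hi, h⟩, h'⟩
    exact ⟨h ▸ hi, fun y z hy hz hyz => h' _ y hyz z rfl hy hz⟩
  · rintro ⟨h, h'⟩
    exact ⟨⟨_, h, rfl⟩, fun i y hy z hz hyx hzx => h' y z hyx hzx (hy.trans hz.symm)⟩

/-- A list has only one suffix of each length. -/
theorem ofPath_mem_VX (hG : M.coxeterGraph.IsAcyclic) {l : List B} (h : IsWhitePath M J l) :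
    ShortestRep.ofPath cs h ∈ VX (cs.ShortestRep J) := by
  refine cs.mem_VX_iff.2 ⟨?_, fun y z hy hz hyz => ?_⟩
  · rw [cs.length_ofPath]
    exact List.length_pos_iff.2 h.ne_nil
  · obtain ⟨l1, hs1, h1, rfl⟩ := cs.exists_isSuffix_of_le hG h hy
    obtain ⟨l2, hs2, h2, rfl⟩ := cs.exists_isSuffix_of_le hG h hz
    have e1 := (h.isReduced_of_isSuffix cs hs1).eq
    have e2 := (h.isReduced_of_isSuffix cs hs2).eq
    change cs.length (cs.wordProd l1) = cs.length (cs.wordProd l2) at hyz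
    rw [e1, e2] at hyz
    have : l1 = l2 := (List.suffix_of_suffix_length_le hs1 hs2 hyz.le).eq_of_length hyz
    subst this
    rfl

theorem ofWord_singleton_of_mem {ω : List B} (hω : cs.IsReduced ω) {h} {s : B} (hs : s ∉ J)
    (hmem : s ∈ ω) : ShortestRep.ofPath cs (isWhitePath_singleton (M := M) hs) ≤
      ShortestRep.ofWord (J := J) cs ω h :=
  ShortestRep.ofWord_le hω (List.singleton_sublist.2 hmem)

/-- A reduced word `i :: l` with `l` a white path through `i` has a right descent in `J`. -/
theorem exists_isRightDescent_of_mem (hG : M.coxeterGraph.IsAcyclic)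
    (hJ : ∀ s ∈ J, ∀ t, M.coxeterGraph.Adj s t → M s t = 3) {i : B} {l : List B}
    (h : IsWhitePath M J l) (hred : cs.IsReduced (i :: l)) (hi : i ∈ l) :
    ∃ j ∈ J, cs.IsRightDescent (cs.wordProd (i :: l)) j := by
  obtain ⟨p, q, rfl⟩ := List.append_of_mem hi
  rcases p.eq_nil_or_concat with rfl | ⟨p, u, rfl⟩
  · exfalso
    have h1 := hred.eq
    have h2 := cs.length_wordProd_le q
    rw [List.nil_append, wordProd_cons, wordProd_cons, simple_mul_simple_cancel_left] at h1
    simp only [List.length_cons] at h1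
    omega
  rw [List.concat_eq_append, List.append_assoc, List.singleton_append] at h hi hred ⊢
  obtain ⟨huJ, hnot, hadj, hq⟩ := isWhitePath_cons_cons.1 (h.of_append (l := u :: i :: q) (by simp))
  refine ⟨u, huJ, ?_⟩
  -- Along the path the only neighbour of `i` before it is `u`, so `i` can be moved across `p`.
  -- Likewise `u` commutes with all of `q`.
  have hpi : ∀ k ∈ p, M i k = 2 := by
    intro k hk
    by_contra hne
    have hnd := h.1.2
    have hki : i ≠ k := by
      rintro rfl
      exact (List.nodup_append.1 hnd).2.2 i hk i (by simp) rfl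
    have h1 : M.coxeterGraph.IsPathList (i :: u :: p.reverse) := by
      have : p ++ u :: i :: q = (p ++ [u, i]) ++ q := by simp
      rw [this] at h
      simpa using h.1.of_append_left.reverse
    have := hG.eq_head_of_adj h1 (by simp [hk] : k ∈ u :: p.reverse) ⟨hki, hne⟩
    subst this
    exact (List.nodup_append.1 hnd).2.2 k hk k (by simp) rfl
  have huq : ∀ k ∈ q, M u k = 2 := by
    intro k hk
    by_contra hne
    have hku : u ≠ k := by
      rintro rfl
      exact hnot (by simp [hk])
    have h1 := (h.of_append (l := u :: i :: q) (by simp)).1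
    have := hG.eq_head_of_adj h1 (by simp [hk] : k ∈ i :: q) ⟨hku, hne⟩
    subst this
    exact (List.nodup_cons.1 hq.1.2).1 hk
  have h3 := hJ u huJ i hadj
  have hbraid : cs.simple i * cs.simple u * cs.simple i =
      cs.simple u * cs.simple i * cs.simple u := by
    have := cs.wordProd_braidWord_eq u i
    simpa [braidWord, M.symmetric i u, h3, alternatingWord, wordProd_cons, mul_assoc] using this
  -- The braid relation turns `p i u i q` into `p u i u q`, whose second `u` can be moved to the
  -- end.
  have e : cs.wordProd (i :: (p ++ u :: i :: q)) = cs.wordProd (p ++ u :: i :: u :: q) := by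
    rw [wordProd_cons, wordProd_append, ← mul_assoc, (cs.commute_wordProd hpi).eq, mul_assoc,
      wordProd_append]
    congr 1
    simp only [wordProd_cons, ← mul_assoc]
    rw [hbraid]
  have hred' : cs.IsReduced ((p ++ [u, i]) ++ u :: q) := by
    have h1 := hred.eq
    rw [e] at h1
    simp only [IsReduced, List.append_assoc, List.cons_append, List.nil_append]
    rw [h1]
    simp only [List.length_append, List.length_cons]
    omega
  have := cs.isRightDescent_of_commute hred' huq
  rw [e]
  simpa using this

/-- By induction the word is `i :: l` with `l` a white path. A repeated `i` gives a descent in `J`,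
and a black `i` gives a second element of rank one. So `i` is a new white letter with a neighbour on
`l`, and uniqueness in each rank forces this neighbour to be the first vertex. -/
theorem exists_ofPath_of_mem_VX (hG : M.coxeterGraph.IsAcyclic)
    (hJ : ∀ s ∈ J, ∀ t, M.coxeterGraph.Adj s t → M s t = 3) {x : cs.ShortestRep J}
    (hx : x ∈ VX (cs.ShortestRep J)) :
    ∃ (l : List B) (h : IsWhitePath M J l), x = ShortestRep.ofPath cs h := by
  obtain ⟨ω, hω, h, rfl⟩ := x.exists_word
  induction ω with
  | nil =>
    have := (cs.mem_VX_iff.1 hx).1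
    simp [ShortestRep.ofWord] at this
  | cons i ω ih =>
    have h' : ∀ j ∈ J, ¬ cs.IsRightDescent (cs.wordProd ω) j := fun j hj =>
      cs.not_isRightDescent_of_cons hω (h j hj)
    have hle : ShortestRep.ofWord cs ω h' ≤ ShortestRep.ofWord cs (i :: ω) h :=
      ShortestRep.ofWord_le hω (List.sublist_cons_self _ _)
    obtain ⟨-, huniq⟩ := cs.mem_VX_iff.1 hx
    rcases ω with _ | ⟨k, ω⟩
    · have hi : i ∉ J := fun hi => h i hi (by
        simp [IsRightDescent])
      exact ⟨[i], isWhitePath_singleton hi, rfl⟩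
    obtain ⟨l, hl, he⟩ := ih hω.of_cons h' (cs.mem_VX_iff.2 ⟨by
      change 0 < cs.length (cs.wordProd _)
      rw [hω.of_cons.eq]; simp, fun y z hy hz => huniq y z (hy.trans hle) (hz.trans hle)⟩)
    have hw : cs.wordProd (k :: ω) = cs.wordProd l := congrArg Subtype.val he
    have hw' : cs.wordProd (i :: k :: ω) = cs.wordProd (i :: l) := by
      rw [wordProd_cons, hw, ← wordProd_cons]
    have hlen : (k :: ω).length = l.length := by
      rw [← hω.of_cons.eq, hw, (hl.isReduced cs).eq]
    have hred : cs.IsReduced (i :: l) := by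
      have := hω.eq
      rw [hw'] at this
      rw [IsReduced, this, List.length_cons, hlen, List.length_cons]
    clear ih
    have hdesc : ∀ j ∈ J, ¬ cs.IsRightDescent (cs.wordProd (i :: l)) j := hw' ▸ h
    have hx' : ShortestRep.ofWord cs (i :: k :: ω) h = ShortestRep.ofWord cs (i :: l) hdesc :=
      Subtype.ext hw'
    rw [hx'] at huniq ⊢
    clear hx' hx hle h h' he hω hw hw' hlen
    have hil : i ∉ l := by
      intro hil
      obtain ⟨j, hj, hd⟩ := cs.exists_isRightDescent_of_mem hG hJ hl hred hil
      exact hdesc j hj hd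
    have hiJ : i ∈ J := by
      by_contra hi
      obtain ⟨-, m, s, rfl, hs, -⟩ := id hl
      have h1 := huniq _ _ (cs.ofWord_singleton_of_mem hred hi (by simp))
        (cs.ofWord_singleton_of_mem hred hs (by simp)) (by rw [length_ofPath, length_ofPath]; rfl)
      have h2 := congrArg Subtype.val h1
      simp only [ShortestRep.ofPath, ShortestRep.ofWord, wordProd_singleton] at h2
      exact hil (by simp [cs.simple_injective h2])
    obtain ⟨p, hp, hip⟩ : ∃ p ∈ l, M i p ≠ 2 := by
      by_contra! hc
      exact hdesc i hiJ (cs.isRightDescent_of_commute (a := []) hred hc)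
    obtain ⟨a, b, rfl⟩ := List.append_of_mem hp
    have hadj : M.coxeterGraph.Adj i p := ⟨fun e => hil (e ▸ hp), hip⟩
    rcases a.eq_nil_or_concat with rfl | ⟨a, u, rfl⟩
    · exact ⟨_, isWhitePath_cons_cons.2 ⟨hiJ, hil, hadj, hl⟩, rfl⟩
    -- If the neighbour `p` has a predecessor `u` on the path, then `u :: p :: b` and `i :: p :: b`
    -- give two different elements of the same rank.
    exfalso
    rw [List.concat_eq_append, List.append_assoc, List.singleton_append] at hil hl
    have hlu : IsWhitePath M J (u :: p :: b) := hl.of_append (by simp)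
    have hli : IsWhitePath M J (i :: p :: b) := by
      obtain ⟨-, -, -, h4⟩ := isWhitePath_cons_cons.1 hlu
      refine isWhitePath_cons_cons.2 ⟨hiJ, fun h => hil ?_, hadj, h4⟩
      exact List.mem_append_right _ (List.mem_cons_of_mem _ h)
    have h1 := huniq (ShortestRep.ofPath cs hlu) (ShortestRep.ofPath cs hli)
      (ShortestRep.ofWord_le hred (by
        rw [List.concat_eq_append, List.append_assoc, List.singleton_append]
        exact (List.sublist_append_right _ _).trans (List.sublist_cons_self _ _)))
      (ShortestRep.ofWord_le hred ((List.sublist_append_right _ _).cons_cons i))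
      (by rw [length_ofPath, length_ofPath]; rfl)
    have h2 := congrArg Subtype.val h1
    simp only [ShortestRep.ofPath, ShortestRep.ofWord] at h2
    rw [wordProd_cons, wordProd_cons _ i, mul_right_cancel_iff] at h2
    exact hil (by simp [cs.simple_injective h2])

/-- The last vertex is the only right descent of a path, so the group element determines it, and it
can be split off. -/
theorem ofPath_injective {l l' : List B} (h : IsWhitePath M J l) (h' : IsWhitePath M J l')
    (he : ShortestRep.ofPath cs h = ShortestRep.ofPath cs h') : l = l' := by
  have key : ∀ n : ℕ, ∀ l l' : List B, l.length = n → M.coxeterGraph.IsPathList l →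
      M.coxeterGraph.IsPathList l' → cs.wordProd l = cs.wordProd l' → l = l' := by
    intro n
    induction n with
    | zero =>
      intro l l' hl h h' he
      rw [List.length_eq_zero_iff] at hl
      subst hl
      have := (cs.isReduced_of_nodup h'.2).eq
      rw [← he] at this
      simpa [eq_comm] using this
    | succ n ih =>
      intro l l' hl h h' he
      have hlen : l.length = l'.length := by
        rw [← (cs.isReduced_of_nodup h.2).eq, ← (cs.isReduced_of_nodup h'.2).eq, he]
      rcases l.eq_nil_or_concat with rfl | ⟨m, s, rfl⟩
      · simp at hl
      rcases l'.eq_nil_or_concat with rfl | ⟨m', s', rfl⟩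
      · simp at hlen
      rw [List.concat_eq_append] at *
      rw [List.concat_eq_append] at *
      have hd := cs.isRightDescent_of_commute (a := m) (b := []) (i := s)
        (cs.isReduced_of_nodup h.2) (by simp)
      rw [he] at hd
      have hss : s = s' := by
        by_contra hss
        exact cs.not_isRightDescent_of_blocked h'.2
          (blocked_of_isChain h'.1 (K := {s}) (by simpa using Ne.symm hss)) s rfl hd
      subst hss
      rw [wordProd_append, wordProd_append, mul_right_cancel_iff] at he
      rw [ih m m' (by simpa using hl) h.of_append_left h'.of_append_left he]
  exact key _ l l' rfl h.1 h'.1 (congrArg Subtype.val he)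

end CoxeterSystem

/-! ### Dihedral words and the numbers `mu` -/

namespace CoxeterSystem

variable {B W : Type*} [Group W] {M : CoxeterMatrix B} (cs : CoxeterSystem M W)

open PointedPoset

theorem length_wordProd_mod_two (ω : List B) : cs.length (cs.wordProd ω) % 2 = ω.length % 2 := by
  induction ω with
  | nil => simp
  | cons i ω ih =>
    rw [wordProd_cons, List.length_cons]
    rcases cs.length_simple_mul (cs.wordProd ω) i with h | h <;> omega

theorem mem_alternatingWord {i j k : B} {n : ℕ} (h : k ∈ alternatingWord i j n) :
    k = i ∨ k = j := by
  induction n generalizing i j with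
  | zero => simp [alternatingWord] at h
  | succ n ih =>
    rw [alternatingWord_succ, List.concat_eq_append, List.mem_append, List.mem_singleton] at h
    rcases h with h | h
    · exact (ih h).symm
    · exact Or.inr h

theorem IsReduced.ne_of_cons_cons {cs : CoxeterSystem M W} {i j : B} {ω : List B}
    (h : cs.IsReduced (i :: j :: ω)) : i ≠ j := by
  rintro rfl
  have h1 := h.eq
  have h2 := cs.length_wordProd_le ω
  rw [wordProd_cons, wordProd_cons, simple_mul_simple_cancel_left] at h1
  simp only [List.length_cons] at h1
  omega

theorem IsReduced.eq_alternatingWord {cs : CoxeterSystem M W} {a b : B} {ω : List B}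
    (h : cs.IsReduced ω) (hω : ∀ i ∈ ω, i = a ∨ i = b) :
    ω = alternatingWord a b ω.length ∨ ω = alternatingWord b a ω.length := by
  have step : ∀ {a b c : B} {n : ℕ}, (c = a ∨ c = b) →
      cs.IsReduced (c :: alternatingWord a b (n + 1)) →
      c :: alternatingWord a b (n + 1) = alternatingWord a b (n + 2) := by
    intro a b c n hc hred
    rw [alternatingWord_succ' a b n] at hred
    rw [alternatingWord_succ' a b (n + 1)]
    have := hred.ne_of_cons_cons
    congr 1
    by_cases hn : Even n <;> simp only [hn, Nat.even_add_one, if_true, if_false, not_true,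
      not_false_iff] at this ⊢ <;> tauto
  induction ω with
  | nil => simp [alternatingWord]
  | cons c ω ih =>
    have hc := hω c (by simp)
    rcases ω with _ | ⟨d, ω⟩
    · rcases hc with rfl | rfl <;> simp [alternatingWord]
    · rcases ih h.of_cons fun i hi => hω i (by simp [hi]) with h1 | h1
      · left
        rw [h1] at h
        exact (congrArg (c :: ·) h1).trans (step hc h)
      · right
        rw [h1] at h
        exact (congrArg (c :: ·) h1).trans (step hc.symm h)

/-- Otherwise a shorter word of the same parity has the same product, and it alternates as well.
Comparing the two gives a trivial power of the product of `a` and `b` with positive exponent less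
than `n`, against the order of that product. -/
theorem isReduced_alternatingWord {a b : B} (hab : a ≠ b) {n : ℕ} (hn : M a b = 0 ∨ n ≤ M a b) :
    cs.IsReduced (alternatingWord a b n) := by
  obtain ⟨ω, hsub, hred, he⟩ := cs.exists_isReduced_sublist (alternatingWord a b n)
  have hlen := hsub.length_le
  rw [length_alternatingWord] at hlen
  rcases hlen.eq_or_lt with hlen | hlen
  · rwa [← hsub.eq_of_length (by rw [hlen, length_alternatingWord])]
  exfalso
  have hpar := cs.length_wordProd_mod_two ω
  rw [he, cs.length_wordProd_mod_two, length_alternatingWord] at hpar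
  have hdvd : ∀ k, (cs.simple a * cs.simple b) ^ k = 1 → 0 < k → k < n → False := by
    intro k hk h0 hkn
    have := cs.dvd_of_simple_mul_pow hab hk
    rcases hn with hn | hn
    · rw [hn, zero_dvd_iff] at this
      omega
    · exact absurd (Nat.le_of_dvd h0 this) (by omega)
  have hinv : cs.simple b * cs.simple a = (cs.simple a * cs.simple b)⁻¹ := by simp
  have halt := hred.eq_alternatingWord fun i hi => mem_alternatingWord (hsub.subset hi)
  generalize ω.length = k at *
  set x := cs.simple a * cs.simple b with hx
  rcases halt with rfl | rfl
  · rw [prod_alternatingWord_eq_mul_pow, prod_alternatingWord_eq_mul_pow] at he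
    have hev : Even k ↔ Even n := by rw [Nat.even_iff, Nat.even_iff, hpar]
    simp only [hev, mul_right_inj, ← hx] at he
    refine hdvd (n / 2 - k / 2) ?_ (by omega) (by omega)
    rw [pow_sub _ (by omega), he, mul_inv_cancel]
  · rw [prod_alternatingWord_eq_mul_pow, prod_alternatingWord_eq_mul_pow, hinv, ← hx,
      inv_pow] at he
    have hev : Even k ↔ Even n := by rw [Nat.even_iff, Nat.even_iff, hpar]
    by_cases h : Even n
    · simp only [hev, h, if_true, one_mul] at he
      refine hdvd (n / 2 + k / 2) ?_ (by omega) (by omega)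
      rw [pow_add, ← he, inv_mul_cancel]
    · simp only [hev, h, if_false] at he
      -- For odd lengths the exponent is `(n + k) / 2`; it is less than `n` because `k < n`. The
      -- summand `1` makes up for the two roundings.
      rw [Nat.not_even_iff] at h
      refine hdvd (n / 2 + k / 2 + 1) ?_ (by omega) (by omega)
      rw [mul_inv_eq_iff_eq_mul, mul_assoc, ← pow_add] at he
      calc x ^ (n / 2 + k / 2 + 1) = cs.simple a * (cs.simple b * x ^ (n / 2 + k / 2)) := by
            rw [pow_succ', hx, mul_assoc]
        _ = 1 := by rw [← he, simple_mul_simple_self]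

variable {J : Set B}

theorem not_isRightDescent_of_forall_notMem {ω : List B} (h : ∀ i ∈ ω, i ∉ J) :
    ∀ i ∈ J, ¬ cs.IsRightDescent (cs.wordProd ω) i := by
  intro i hi hd
  obtain ⟨a, k, b, rfl, he⟩ := cs.right_exchange hd
  rw [← eq_inv_mul_iff_mul_eq] at he
  have h1 : cs.simple i ∈ cs.parabolic {j | j ∈ a ++ k :: b} := by
    rw [he]
    exact mul_mem (inv_mem (cs.wordProd_mem_parabolic fun _ h => h))
      (cs.wordProd_mem_parabolic fun j hj => by simp at hj ⊢; tauto)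
  exact h i (cs.mem_of_simple_mem_parabolic h1) hi

theorem mem_of_ofPath_singleton_le {a : B} {ha : IsWhitePath M J [a]} {ω : List B} {h}
    (hle : ShortestRep.ofPath cs ha ≤ ShortestRep.ofWord cs ω h) : a ∈ ω := by
  obtain ⟨ω', hs, -, _, he⟩ := ShortestRep.exists_sublist hle
  have h1 : cs.simple a = cs.wordProd ω' * (cs.wordProd [])⁻¹ := by
    simpa [ShortestRep.ofPath, ShortestRep.ofWord] using congrArg Subtype.val he
  rcases cs.mem_of_simple_eq_wordProd_mul h1 with h2 | h2
  · exact hs.subset h2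
  · simp at h2

theorem mem_layerTwo_of_word {a b c d : B} (ha : IsWhitePath M J [a]) (hb : IsWhitePath M J [b])
    (hcd : (c = a ∧ d = b) ∨ (c = b ∧ d = a)) (hred : cs.IsReduced [c, d]) (h) :
    ShortestRep.ofWord cs [c, d] h ∈
      layerTwo {ShortestRep.ofPath cs ha, ShortestRep.ofPath cs hb} := by
  have hlen : cs.length (ShortestRep.ofWord (J := J) cs [c, d] h).1 = 2 := hred.eq
  refine ⟨ShortestRep.mem_layer.2 hlen, fun y => ?_⟩
  simp only [Set.mem_insert_iff, Set.mem_singleton_iff]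
  have hcov : ∀ e (he : IsWhitePath M J [e]), e ∈ [c, d] →
      ShortestRep.ofPath cs he ⋖ ShortestRep.ofWord cs [c, d] h := by
    intro e he hmem
    refine ShortestRep.covBy_of_length
      (ShortestRep.ofWord_le hred (List.singleton_sublist.2 hmem)) ?_
    rw [hlen, length_ofPath]
    rfl
  constructor
  · intro hy
    obtain ⟨ω, hs, hω, h', rfl⟩ := ShortestRep.exists_sublist hy.le
    have hl := ShortestRep.length_lt hy.lt
    rw [hlen] at hl
    change cs.length (cs.wordProd ω) < 2 at hl
    rw [hω.eq] at hl
    rcases ω with _ | ⟨e, _ | ⟨_, ω⟩⟩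
    · exfalso
      refine hy.2 (c := ShortestRep.ofPath cs ha) ?_ (hcov a ha ?_).lt
      · refine lt_of_le_of_ne (ShortestRep.ofWord_le (ha.isReduced cs) (by simp)) fun he => ?_
        have := congrArg (fun x => cs.length x.1) he
        simp [ShortestRep.ofPath, ShortestRep.ofWord] at this
      · rcases hcd with ⟨rfl, rfl⟩ | ⟨rfl, rfl⟩ <;> simp
    · have he : e = a ∨ e = b := by
        have := hs.subset (List.mem_singleton_self e)
        simp at this
        rcases hcd with ⟨rfl, rfl⟩ | ⟨rfl, rfl⟩
        · exact this
        · exact this.symm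
      rcases he with rfl | rfl
      · exact Or.inl rfl
      · exact Or.inr rfl
    · simp at hl
  · rintro (rfl | rfl)
    · exact hcov a ha (by rcases hcd with ⟨rfl, rfl⟩ | ⟨rfl, rfl⟩ <;> simp)
    · exact hcov b hb (by rcases hcd with ⟨rfl, rfl⟩ | ⟨rfl, rfl⟩ <;> simp)

theorem alternatingWord_mem_lowerPart {a b : B} (ha : IsWhitePath M J [a])
    (hb : IsWhitePath M J [b]) {n : ℕ} (hred : cs.IsReduced (alternatingWord a b n)) (h) :
    ShortestRep.ofWord cs (alternatingWord a b n) h ∈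
      lowerPart {ShortestRep.ofPath cs ha, ShortestRep.ofPath cs hb} := by
  have hlen : cs.length (ShortestRep.ofWord (J := J) cs (alternatingWord a b n) h).1 = n := by
    have := hred.eq
    rwa [length_alternatingWord] at this
  rcases (by omega : n = 0 ∨ n = 1 ∨ 1 < n) with rfl | rfl | hn
  · exact Or.inl (Or.inl (ShortestRep.mem_layer.2 hlen))
  · exact Or.inl (Or.inr (Or.inr rfl))
  · refine Or.inr ⟨⟨n, hn, ShortestRep.mem_layer.2 hlen⟩, fun y hy hle => ?_⟩
    obtain ⟨ω, hs, hω, h', rfl⟩ := ShortestRep.exists_sublist hle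
    have hl := ShortestRep.mem_layer.1 hy
    change cs.length (cs.wordProd ω) = 2 at hl
    rw [hω.eq, List.length_eq_two] at hl
    obtain ⟨c, d, rfl⟩ := hl
    have hc := mem_alternatingWord (hs.subset (by simp : c ∈ [c, d]))
    have hd := mem_alternatingWord (hs.subset (by simp : d ∈ [c, d]))
    have hne := hω.ne_of_cons_cons
    refine cs.mem_layerTwo_of_word ha hb ?_ hω _
    rcases hc with rfl | rfl <;> rcases hd with rfl | rfl <;> simp at hne ⊢

/-- A foreign first letter would form, with a suitable later letter, an element of rank two below
`x` that does not cover both `a` and `b`. -/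
theorem eq_or_eq_of_mem_lowerPart {a b : B} (hab : a ≠ b) (ha : IsWhitePath M J [a])
    (hb : IsWhitePath M J [b]) {ω : List B} (hω : cs.IsReduced ω) (hn : 1 < ω.length) {h}
    (hlow : ∀ y ∈ layer (cs.ShortestRep J) 2, y ≤ ShortestRep.ofWord cs ω h →
      y ∈ layerTwo {ShortestRep.ofPath cs ha, ShortestRep.ofPath cs hb}) :
    ∀ i ∈ ω, i = a ∨ i = b := by
  have two : ∀ {c d : B} {h'}, cs.IsReduced [c, d] →
      ShortestRep.ofWord cs [c, d] h' ≤ ShortestRep.ofWord cs ω h →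
      (c = a ∧ d = b) ∨ (c = b ∧ d = a) := by
    intro c d h' hcd hle
    have h2 := hlow _ (ShortestRep.mem_layer.2 hcd.eq) hle
    have h3 := cs.mem_of_ofPath_singleton_le ((h2.2 _).2 (Or.inl rfl)).le
    have h4 := cs.mem_of_ofPath_singleton_le ((h2.2 _).2 (Or.inr rfl)).le
    simp only [List.mem_cons, List.not_mem_nil, or_false] at h3 h4
    rcases h3 with rfl | rfl <;> rcases h4 with rfl | rfl <;> simp at hab ⊢
  induction ω with
  | nil => simp at hn
  | cons i ω ih =>
    have h' : ∀ j ∈ J, ¬ cs.IsRightDescent (cs.wordProd ω) j := fun j hj =>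
      cs.not_isRightDescent_of_cons hω (h j hj)
    have hle : ShortestRep.ofWord cs ω h' ≤ ShortestRep.ofWord cs (i :: ω) h :=
      ShortestRep.ofWord_le hω (List.sublist_cons_self _ _)
    rcases ω with _ | ⟨j, ω⟩
    · simp at hn
    rcases ω with _ | ⟨k, ω⟩
    · rcases two hω le_rfl with ⟨rfl, rfl⟩ | ⟨rfl, rfl⟩ <;> simp
    have hrest := ih hω.of_cons (by simp) (h := h')
      (fun y hy hyle => hlow y hy (hyle.trans hle)) (fun hred hle' => two hred (hle'.trans hle))
    have hi : i = a ∨ i = b := by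
      by_contra hi
      rw [not_or] at hi
      -- A white `i` needs a later letter with which it does not commute in order that `[i, c]`
      -- represent an element of `W^J`. For a black `i` any letter of the tail will do.
      obtain ⟨c, hc, hic⟩ : ∃ c ∈ j :: k :: ω, i ∈ J → M i c ≠ 2 := by
        by_cases hiJ : i ∈ J
        · obtain ⟨c, hc, hne⟩ := (cs.blocked_of_not_isRightDescent hω h).1 hiJ
          exact ⟨c, hc, fun _ => hne⟩
        · exact ⟨j, by simp, fun h => absurd h hiJ⟩
      have hcab := hrest c hc
      have hcJ : c ∉ J := by
        rcases hcab with rfl | rfl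
        · exact isWhitePath_singleton_iff.1 ha
        · exact isWhitePath_singleton_iff.1 hb
      have hne : i ≠ c := by
        rintro rfl
        exact hcab.elim hi.1 hi.2
      have hnd : [i, c].Nodup := by simpa using hne
      have hbl : Blocked M J [i, c] :=
        ⟨fun hiJ => ⟨c, by simp, hic hiJ⟩, fun h => absurd h hcJ, trivial⟩
      rcases two (h' := cs.not_isRightDescent_of_blocked hnd hbl) (cs.isReduced_of_nodup hnd)
        (ShortestRep.ofWord_le hω ((List.singleton_sublist.2 hc).cons_cons i)) with h1 | h1
      · exact hi.1 h1.1
      · exact hi.2 h1.1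
    intro c hc
    rcases List.mem_cons.1 hc with rfl | hc
    · exact hi
    · exact hrest c hc

/-- Beyond rank one, the elements concerned are the reduced alternating words in `a` and `b`, whose
lengths go up to `m(a,b)`. -/
theorem nonempty_layer_inter_lowerPart {a b : B} (hab : a ≠ b) (ha : IsWhitePath M J [a])
    (hb : IsWhitePath M J [b]) {n : ℕ} : (layer (cs.ShortestRep J) n ∩
      lowerPart {ShortestRep.ofPath cs ha, ShortestRep.ofPath cs hb}).Nonempty ↔
      M a b = 0 ∨ n ≤ M a b := by
  constructor
  · rintro ⟨x, hx, hlow⟩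
    rw [ShortestRep.mem_layer] at hx
    by_contra! hcon
    have hn : 1 < n := by omega
    rcases hlow with (h0 | h1) | ⟨-, hlow⟩
    · rw [ShortestRep.mem_layer] at h0
      omega
    · rcases h1 with rfl | rfl <;> rw [length_ofPath] at hx <;> simp at hx <;> omega
    · obtain ⟨ω, hω, h, rfl⟩ := x.exists_word
      change cs.length (cs.wordProd ω) = n at hx
      rw [hω.eq] at hx
      have hmem := cs.eq_or_eq_of_mem_lowerPart hab ha hb hω (by omega) hlow
      rcases hω.eq_alternatingWord hmem with he | he <;> rw [he, hx] at hω
      · exact cs.not_isReduced_alternatingWord a b hcon.1 hcon.2 hω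
      · rw [M.symmetric] at hcon
        exact cs.not_isReduced_alternatingWord b a hcon.1 hcon.2 hω
  · intro hn
    have hred := cs.isReduced_alternatingWord hab hn
    have h := cs.not_isRightDescent_of_forall_notMem (J := J) (ω := alternatingWord a b n)
      fun i hi => by
        rcases mem_alternatingWord hi with rfl | rfl
        · exact isWhitePath_singleton_iff.1 ha
        · exact isWhitePath_singleton_iff.1 hb
    refine ⟨ShortestRep.ofWord cs _ h, ?_, cs.alternatingWord_mem_lowerPart ha hb hred h⟩
    rw [ShortestRep.mem_layer]
    exact hred.eq.trans (length_alternatingWord _ _ _)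

theorem mu_ofPath {a b : B} (hab : a ≠ b) (ha : IsWhitePath M J [a]) (hb : IsWhitePath M J [b]) :
    mu (ShortestRep.ofPath cs ha) (ShortestRep.ofPath cs hb) =
      if M a b = 0 then ⊤ else (M a b : ℕ∞) := by
  simp only [mu, cs.nonempty_layer_inter_lowerPart hab ha hb, Set.mem_ofPred_eq]
  split_ifs with h
  · simp only [h, true_or, iSup_true]
    exact ENat.iSup_natCast
  · simp only [h, false_or]
    exact le_antisymm (iSup₂_le fun i hi => by exact_mod_cast hi)
      (le_iSup₂ (f := fun (i : ℕ) (_ : i ≤ M a b) => (i : ℕ∞)) (M a b) le_rfl)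

end CoxeterSystem

namespace List

theorem Sublist.exists_insert {α : Type*} {a : α} {l l' : List α} (h : l'.Sublist l) (ha : a ∈ l)
    (ha' : a ∉ l') : ∃ p q, l' = p ++ q ∧ (p ++ a :: q).Sublist l := by
  obtain ⟨u, v, rfl⟩ := append_of_mem ha
  obtain ⟨p, q, rfl, hp, hq⟩ := sublist_append_iff.1 h
  refine ⟨p, q, rfl, hp.append (Sublist.cons_cons a ?_)⟩
  rcases sublist_cons_iff.1 hq with hq | ⟨r, rfl, -⟩
  · exact hq
  · simp at ha'

end List

/-! ### Attachment, coverings and the matrix entries -/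

namespace CoxeterSystem

variable {B W : Type*} [Group W] {M : CoxeterMatrix B} (cs : CoxeterSystem M W)

open PointedPoset

/-- The first letter is a left descent of an element of the parabolic subgroup, so exchange
expresses it through letters in `K`. -/
theorem IsReduced.mem_of_mem_parabolic {cs : CoxeterSystem M W} {ω : List B}
    (hω : cs.IsReduced ω) {K : Set B} (h : cs.wordProd ω ∈ cs.parabolic K) : ∀ i ∈ ω, i ∈ K := by
  induction ω with
  | nil => simp
  | cons i ω ih =>
    obtain ⟨η, hη, he⟩ := cs.exists_wordProd_of_mem_parabolic h
    have hd : cs.IsLeftDescent (cs.wordProd η) i := by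
      have := hω.not_isLeftDescent
      rwa [cs.isLeftDescent_iff_not_isLeftDescent_mul, ← he, wordProd_cons,
        simple_mul_simple_cancel_left]
    obtain ⟨a, k, b, rfl, hab⟩ := cs.left_exchange hd
    have hi : i ∈ K := by
      rw [← eq_mul_inv_iff_mul_eq] at hab
      rcases cs.mem_of_simple_eq_wordProd_mul hab with h1 | h1
      · exact hη i (by simp at h1 ⊢; tauto)
      · exact hη i h1
    have hrest : cs.wordProd ω ∈ cs.parabolic K := by
      rw [wordProd_cons] at h
      have hs : cs.simple i ∈ cs.parabolic K := Subgroup.subset_closure ⟨i, hi, rfl⟩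
      exact (Subgroup.mul_mem_cancel_left _ hs).1 h
    have := ih hω.of_cons hrest
    simpa [hi] using this

variable {J : Set B}

theorem blocked_concat {l : List B} (h : Blocked M J l) {a : B} (ha : a ∉ J) :
    Blocked M J (l ++ [a]) := by
  induction l with
  | nil => exact ⟨fun h => absurd h ha, trivial⟩
  | cons i l ih =>
    refine ⟨fun hi => ?_, ih h.2⟩
    obtain ⟨j, hj, hne⟩ := h.1 hi
    exact ⟨j, by simp [hj], hne⟩

/-- If `a` commutes with all letters, then inserting it anywhere into a word for the element gives
the same product. So every cover above `a` is this one element. -/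
theorem not_twoCoversAbove {a : B} (ha : IsWhitePath M J [a]) {l : List B} (hl : l.Nodup) {h}
    (hal : a ∉ l) (hcomm : ∀ c ∈ l, M a c = 2) :
    ¬ TwoCoversAbove (ShortestRep.ofPath cs ha) (ShortestRep.ofWord cs l h) := by
  have hnd : (a :: l).Nodup := List.nodup_cons.2 ⟨hal, hl⟩
  have hb : Blocked M J (a :: l) := ⟨fun h => absurd h (isWhitePath_singleton_iff.1 ha),
    cs.blocked_of_not_isRightDescent (cs.isReduced_of_nodup hl) h⟩
  have hred := cs.isReduced_of_nodup hnd
  have hb' := cs.not_isRightDescent_of_blocked hnd hb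
  have key : ∀ x, ShortestRep.ofWord cs l h ⋖ x → ShortestRep.ofPath cs ha ≤ x →
      x = ShortestRep.ofWord cs (a :: l) hb' := by
    intro x hx hax
    obtain ⟨ω, hω, hω', rfl⟩ := x.exists_word
    have haω := cs.mem_of_ofPath_singleton_le hax
    obtain ⟨η, hη, hηred, hη', he⟩ := ShortestRep.exists_sublist hx.le
    have he' : cs.wordProd l = cs.wordProd η := congrArg Subtype.val he
    have hηl : ∀ i ∈ η, i ∈ l := hηred.mem_of_mem_parabolic (K := {i | i ∈ l}) (by
      rw [← he']
      exact cs.wordProd_mem_parabolic fun _ h => h)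
    -- The subword for the given element avoids `a` while `ω` contains it, so `a` can be inserted
    -- without leaving `ω`.
    obtain ⟨p, q, rfl, hpq⟩ := hη.exists_insert haω fun h => hal (hηl a h)
    have hle : ShortestRep.ofWord cs (a :: l) hb' ≤ ShortestRep.ofWord cs ω hω' := by
      have hp : cs.wordProd (p ++ a :: q) = cs.wordProd (a :: l) := by
        rw [wordProd_append, wordProd_cons, ← mul_assoc, ← (cs.commute_wordProd (i := a)
          fun j hj => hcomm j (hηl j (List.mem_append_left _ hj))).eq, mul_assoc,
          ← wordProd_append, ← he', wordProd_cons]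
      rw [ShortestRep.le_iff]
      change cs.BruhatLE (cs.wordProd (a :: l)) _
      rw [← hp]
      exact cs.bruhatLE_of_sublist hω hpq
    have hlt : ShortestRep.ofWord cs l h < ShortestRep.ofWord cs (a :: l) hb' := by
      refine (ShortestRep.covBy_of_length
        (ShortestRep.ofWord_le hred (List.sublist_cons_self _ _)) ?_).lt
      exact hred.eq.trans (congrArg (· + 1) (cs.isReduced_of_nodup hl).eq.symm)
    rcases hle.eq_or_lt with h1 | h1
    · exact h1.symm
    · exact absurd h1 (hx.2 hlt)
  rintro ⟨-, x₁, x₂, hne, h1, h2, h3, h4⟩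
  exact hne ((key x₁ h1 h3).trans (key x₂ h2 h4).symm)

/-- The two covers put `a` in front of the path and behind it. If they agreed, `a` would commute
with every letter. -/
theorem twoCoversAbove {a : B} (ha : IsWhitePath M J [a]) {l : List B} (h : IsWhitePath M J l)
    (hal : a ∉ l) {c : B} (hc : c ∈ l) (hne : M a c ≠ 2) :
    TwoCoversAbove (ShortestRep.ofPath cs ha) (ShortestRep.ofPath cs h) := by
  have haJ := isWhitePath_singleton_iff.1 ha
  have hbl := cs.blocked_of_not_isRightDescent (h.isReduced cs) (h.not_isRightDescent cs)
  have hnd : (a :: l).Nodup := List.nodup_cons.2 ⟨hal, h.1.2⟩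
  have hnd' : (l ++ [a]).Nodup := by
    have : ∀ b ∈ l, b ≠ a := fun b hb e => hal (e ▸ hb)
    simpa [List.nodup_append, h.1.2] using this
  have hb := cs.not_isRightDescent_of_blocked hnd (J := J) ⟨fun h => absurd h haJ, hbl⟩
  have hb' := cs.not_isRightDescent_of_blocked hnd' (blocked_concat hbl haJ)
  have hred := cs.isReduced_of_nodup hnd
  have hred' := cs.isReduced_of_nodup hnd'
  refine ⟨fun hle => hal (cs.mem_of_ofPath_singleton_le hle), ShortestRep.ofWord cs _ hb,
    ShortestRep.ofWord cs _ hb', fun he => ?_, ?_, ?_, ?_, ?_⟩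
  · have he' : cs.wordProd (a :: l) = cs.wordProd (l ++ [a]) := congrArg Subtype.val he
    rw [wordProd_cons, wordProd_append, wordProd_singleton] at he'
    exact hne (cs.eq_two_of_commute_wordProd h.1.2 hal he' c hc)
  · refine ShortestRep.covBy_of_length
      (ShortestRep.ofWord_le hred (List.sublist_cons_self _ _)) ?_
    rw [length_ofPath]
    exact hred.eq
  · refine ShortestRep.covBy_of_length
      (ShortestRep.ofWord_le hred' (List.sublist_append_left _ _)) ?_
    rw [length_ofPath]
    exact hred'.eq.trans (by simp)
  · exact ShortestRep.ofWord_le hred (by simp)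
  · exact ShortestRep.ofWord_le hred' (by simp)

/-- Starting the path at a neighbour of `a` gives a suffix that has two covers above `a`, so
minimality makes this neighbour the first vertex. Conversely, `a` has at most one neighbour on a
path avoiding it, so it commutes with every letter of a proper suffix. -/
theorem attached_ofPath_iff (hG : M.coxeterGraph.IsAcyclic) {a : B} (ha : IsWhitePath M J [a])
    {t : B} {m : List B} (h : IsWhitePath M J (t :: m)) :
    Attached (ShortestRep.ofPath cs ha) (ShortestRep.ofPath cs h) ↔ a ∉ t :: m ∧ M a t ≠ 2 := by
  have hmem : ∀ c ∈ t :: m, a ∉ t :: m → M a c ≠ 2 → M.coxeterGraph.Adj a c :=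
    fun c hc ha hne => ⟨fun e => ha (e ▸ hc), hne⟩
  constructor
  · rintro ⟨-, htwo, hmin⟩
    have hal : a ∉ t :: m := fun hal =>
      htwo.1 (ShortestRep.ofWord_le (h.isReduced cs) (List.singleton_sublist.2 hal))
    refine ⟨hal, fun hat => ?_⟩
    obtain ⟨c, hc, hne⟩ : ∃ c ∈ t :: m, M a c ≠ 2 := by
      by_contra! hcon
      exact cs.not_twoCoversAbove ha h.1.2 hal hcon htwo
    obtain ⟨u, v, huv⟩ := List.append_of_mem hc
    have hcv : IsWhitePath M J (c :: v) := (huv ▸ h).of_append (by simp)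
    have hsub : (c :: v).Sublist (t :: m) := huv ▸ List.sublist_append_right _ _
    have := hmin (cs.twoCoversAbove ha hcv (fun h => hal (hsub.subset h)) (by simp) hne)
      (ShortestRep.ofWord_le (h.isReduced cs) hsub)
    have hlen := ShortestRep.length_le this
    rw [length_ofPath, length_ofPath, huv] at hlen
    rcases u with _ | ⟨k, u⟩
    · simp only [List.nil_append, List.cons.injEq] at huv
      exact hne (huv.1 ▸ hat)
    · simp at hlen
      omega
  · rintro ⟨hal, hat⟩
    refine ⟨ShortestRep.mem_layer.2 (cs.length_ofPath ha),
      cs.twoCoversAbove ha h hal (by simp) hat, fun y hy hle => ?_⟩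
    obtain ⟨l', hs, h', rfl⟩ := cs.exists_isSuffix_of_le hG h hle
    rcases List.suffix_cons_iff.1 hs with rfl | hs'
    · exact le_rfl
    · refine absurd hy (cs.not_twoCoversAbove ha (h.1.2.sublist hs.sublist)
        (fun h => hal (hs.subset h)) fun c hc => ?_)
      by_contra hne
      have hc' : c ∈ m := hs'.subset hc
      have := hG.eq_of_adj_of_adj h.1 hal (by simp) (by simp [hc'] : c ∈ t :: m)
        (hmem t (by simp) hal hat) (hmem c (by simp [hc']) hal hne)
      subst this
      exact (List.nodup_cons.1 h.1.2).1 hc'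

theorem ofPath_covBy_iff (hG : M.coxeterGraph.IsAcyclic) {l l' : List B} (h : IsWhitePath M J l)
    (h' : IsWhitePath M J l') :
    ShortestRep.ofPath cs h' ⋖ ShortestRep.ofPath cs h ↔ ∃ i, l = i :: l' := by
  constructor
  · intro hcov
    obtain ⟨l₂, hs, h₂, he⟩ := cs.exists_isSuffix_of_le hG h hcov.le
    have hne : l₂ ≠ [] := by
      rintro rfl
      have := congrArg (fun x => cs.length x.1) he
      simp only [length_ofPath] at this
      simp only [ShortestRep.ofWord, wordProd_nil, length_one, List.length_eq_zero_iff] at this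
      exact h'.ne_nil this
    have hl := cs.ofPath_injective h' (h.of_isSuffix hs hne) he
    subst hl
    rcases l with _ | ⟨i, l⟩
    · exact absurd rfl h.ne_nil
    rcases List.suffix_cons_iff.1 hs with rfl | hs'
    · exact absurd rfl hcov.lt.ne
    have hl : IsWhitePath M J l := by
      refine h.of_isSuffix (List.suffix_cons _ _) ?_
      rintro rfl
      exact hne (List.suffix_nil.1 hs')
    refine ⟨i, ?_⟩
    congr 1
    by_contra hne'
    refine hcov.2 (c := ShortestRep.ofPath cs hl) ?_ ?_
    · refine lt_of_le_of_ne (ShortestRep.ofWord_le (hl.isReduced cs) hs'.sublist) fun he => ?_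
      exact hne' (cs.ofPath_injective _ _ he).symm
    · refine lt_of_le_of_ne (ShortestRep.ofWord_le (h.isReduced cs)
        (List.sublist_cons_self _ _)) fun he => ?_
      simpa using congrArg List.length (cs.ofPath_injective _ _ he)
  · rintro ⟨i, rfl⟩
    refine ShortestRep.covBy_of_length (ShortestRep.ofWord_le (h.isReduced cs)
        (List.sublist_cons_self _ _)) ?_
    rw [length_ofPath, length_ofPath, List.length_cons]

theorem ofPath_mem_layer_one_iff {l : List B} (h : IsWhitePath M J l) :
    ShortestRep.ofPath cs h ∈ layer (cs.ShortestRep J) 1 ↔ l.length = 1 := by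
  rw [ShortestRep.mem_layer, length_ofPath]

/-! ### The entries of the Coxeter matrix of the graph of the poset -/

/-- Between black vertices `Attached` amounts to not commuting, so it joins only pairs already
joined by the rule for `mu`. -/
theorem entry_singleton_singleton (hG : M.coxeterGraph.IsAcyclic) {a b : B}
    (ha : IsWhitePath M J [a]) (hb : IsWhitePath M J [b]) :
    entry (ShortestRep.ofPath cs ha) (ShortestRep.ofPath cs hb) = M a b := by
  by_cases hab : a = b
  · subst hab
    simp [entry]
  have hne : ShortestRep.ofPath cs ha ≠ ShortestRep.ofPath cs hb := fun he =>
    hab (by simpa using cs.ofPath_injective _ _ he)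
  have h1 := M.off_diagonal a b hab
  rw [entry, if_neg hne, cs.mu_ofPath hab ha hb]
  rw [cs.attached_ofPath_iff hG, cs.attached_ofPath_iff hG, cs.ofPath_covBy_iff hG,
    cs.ofPath_covBy_iff hG]
  simp only [ofPath_mem_layer_one_iff, List.length_singleton, true_and]
  by_cases h0 : M a b = 0
  · simp [h0]
  · rw [if_neg h0]
    by_cases h3 : 3 ≤ M a b
    · rw [if_pos (by exact_mod_cast h3)]
      simp
    · rw [if_neg (by exact_mod_cast h3)]
      have h2 : M a b = 2 := by omega
      have h2' : M b a = 2 := M.symmetric b a ▸ h2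
      simp [h2, h2']

/-- A neighbour `a` of `t` either lies on the path, which is then `[t, a]` and covers `[a]`, or lies
off the path and is attached to it. -/
theorem entry_singleton_cons (hG : M.coxeterGraph.IsAcyclic)
    (hJ : ∀ s ∈ J, ∀ t, M.coxeterGraph.Adj s t → M s t = 3) {a t : B} {m : List B}
    (ha : IsWhitePath M J [a]) (h : IsWhitePath M J (t :: m)) (hm : m ≠ []) :
    entry (ShortestRep.ofPath cs ha) (ShortestRep.ofPath cs h) = M a t := by
  obtain ⟨u, m, rfl⟩ := List.exists_cons_of_ne_nil hm
  have hne : ShortestRep.ofPath cs ha ≠ ShortestRep.ofPath cs h := fun he => by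
    simpa using cs.ofPath_injective _ _ he
  obtain ⟨htJ, htm, hadj, hu⟩ := isWhitePath_cons_cons.1 h
  have hat : a ≠ t := by
    rintro rfl
    exact isWhitePath_singleton_iff.1 ha htJ
  have hcond : (ShortestRep.ofPath cs ha ⋖ ShortestRep.ofPath cs h ∨
      ShortestRep.ofPath cs h ⋖ ShortestRep.ofPath cs ha ∨
      Attached (ShortestRep.ofPath cs ha) (ShortestRep.ofPath cs h) ∨
      Attached (ShortestRep.ofPath cs h) (ShortestRep.ofPath cs ha)) ↔ M a t ≠ 2 := by
    have : ¬ Attached (ShortestRep.ofPath cs h) (ShortestRep.ofPath cs ha) := by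
      rintro ⟨h1, -⟩
      simp [ofPath_mem_layer_one_iff] at h1
    rw [cs.ofPath_covBy_iff hG, cs.ofPath_covBy_iff hG, cs.attached_ofPath_iff hG]
    simp only [this, or_false, List.cons.injEq, reduceCtorEq, and_false, exists_false, false_or,
      ↓existsAndEq, true_and]
    constructor
    · rintro (⟨rfl, rfl⟩ | ⟨-, h1⟩)
      · rw [M.symmetric]
        exact hadj.2
      · exact h1
    · intro hne
      by_cases hmem : a ∈ u :: m
      · have : a = u := hG.eq_head_of_adj h.1 hmem ⟨hat.symm, by rwa [M.symmetric]⟩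
        subst this
        left
        refine ⟨rfl, ?_⟩
        rcases m with _ | ⟨v, m⟩
        · rfl
        · exact absurd (isWhitePath_cons_cons.1 hu).1 (isWhitePath_singleton_iff.1 ha)
      · right
        exact ⟨fun h => (List.mem_cons.1 h).elim hat hmem, hne⟩
  rw [entry, if_neg hne, if_neg (by simp [ofPath_mem_layer_one_iff])]
  by_cases h2 : M a t = 2
  · rw [if_neg (fun h => hcond.1 h h2), h2]
  · rw [if_pos (hcond.2 h2), M.symmetric, hJ t htJ a ⟨hat.symm, by rwa [M.symmetric]⟩]

open Classical in
theorem entry_cons_cons (hG : M.coxeterGraph.IsAcyclic) {l l' : List B} (h : IsWhitePath M J l)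
    (h' : IsWhitePath M J l') (hl : l.length ≠ 1) (hl' : l'.length ≠ 1) :
    entry (ShortestRep.ofPath cs h) (ShortestRep.ofPath cs h') =
      if l = l' then 1 else if (∃ i, l = i :: l') ∨ ∃ i, l' = i :: l then 3 else 2 := by
  by_cases he : l = l'
  · subst he
    simp [entry]
  have hne : ShortestRep.ofPath cs h ≠ ShortestRep.ofPath cs h' := fun he' =>
    he (cs.ofPath_injective _ _ he')
  rw [entry, if_neg hne, if_neg (by simp [ofPath_mem_layer_one_iff, hl]), if_neg he]
  congr 1
  simp only [Attached, ofPath_mem_layer_one_iff, hl, hl', cs.ofPath_covBy_iff hG, false_and,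
    or_false, eq_iff_iff]
  exact or_comm

end CoxeterSystem

/-! ### The isomorphism with the duplicated graph -/

namespace CoxeterSystem

variable {B W : Type*} [Group W] {M : CoxeterMatrix B} (cs : CoxeterSystem M W)

open PointedPoset BWCoxeterGraph

variable {J : Set B}

theorem pairGraph_white_of_mem {i : B} (h : i ∈ J) : i ∈ (cs.pairGraph J).blackᶜ :=
  fun h' => h' h

theorem mem_of_pairGraph_white {i : B} (h : i ∈ (cs.pairGraph J).blackᶜ) : i ∈ J := not_not.1 h

theorem exists_pathList_of_reachable {x y : ↥((cs.pairGraph J).blackᶜ)}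
    (h : (cs.pairGraph J).whiteGraph.Reachable x y) : ∃ l : List B,
      M.coxeterGraph.IsPathList (x.1 :: l) ∧ (∀ i ∈ x.1 :: l, i ∈ J) ∧
      y.1 ∈ (x.1 :: l).getLast? := by
  obtain ⟨p, hp⟩ := h.exists_isPath
  have hsupp : (p.support.map Subtype.val) = x.1 :: (p.support.tail.map Subtype.val) := by
    rw [← List.map_cons, SimpleGraph.Walk.cons_tail_support]
  refine ⟨p.support.tail.map Subtype.val, ?_, ?_, ?_⟩ <;> rw [← hsupp]
  · refine ⟨?_, (hp.support_nodup).map Subtype.val_injective⟩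
    rw [List.isChain_map]
    exact p.isChain_adj_support
  · intro i hi
    obtain ⟨j, -, rfl⟩ := List.mem_map.1 hi
    exact cs.mem_of_pairGraph_white j.2
  · rw [List.getLast?_map, List.getLast?_eq_getLast_of_ne_nil p.support_ne_nil, p.getLast_support]
    rfl

theorem reachable_of_isChain {x y : B} {l : List B}
    (h : (x :: l).IsChain M.coxeterGraph.Adj) (hJ : ∀ i ∈ x :: l, i ∈ J) (hy : y ∈ x :: l) :
    (cs.pairGraph J).whiteGraph.Reachable ⟨x, cs.pairGraph_white_of_mem (hJ x (by simp))⟩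
      ⟨y, cs.pairGraph_white_of_mem (hJ y hy)⟩ := by
  induction l generalizing x with
  | nil =>
    obtain rfl : y = x := by simpa using hy
    exact SimpleGraph.Reachable.refl _
  | cons z l ih =>
    rcases List.mem_cons.1 hy with rfl | hy'
    · exact SimpleGraph.Reachable.refl _
    · have hadj := (List.isChain_cons_cons.1 h).1
      refine SimpleGraph.Reachable.trans (v := ⟨z, cs.pairGraph_white_of_mem (hJ z (by simp))⟩)
        (SimpleGraph.Adj.reachable (show (cs.pairGraph J).whiteGraph.Adj
          ⟨x, cs.pairGraph_white_of_mem (hJ x (by simp))⟩ ⟨z, _⟩ from hadj)) ?_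
      exact ih h.of_cons (fun i hi => hJ i (List.mem_cons_of_mem _ hi)) hy'

/-- The white path which corresponds to a vertex of the duplicated graph leads from the white
vertex in question to the black vertex to which the copy of its component belongs. -/
def IsPathOf : (cs.pairGraph J).DupVertex → List B → Prop
  | .inl a, l => l = [a.1]
  | .inr y, l => ∃ m, l = y.2.2.1.1 :: (m ++ [y.2.1.1])

/-- A path inside the white component leads from `t` to a neighbour of `s`, and `s` is appended. -/
theorem exists_isPathOf (d : (cs.pairGraph J).DupVertex) :
    ∃ l, IsWhitePath M J l ∧ cs.IsPathOf d l := by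
  rcases d with ⟨a, ha⟩ | ⟨C, ⟨s, hs, t', ht', hadj⟩, ⟨t, ht⟩⟩
  · exact ⟨[a], isWhitePath_singleton ha, rfl⟩
  · obtain ⟨l, hp, hJ, hlast⟩ := cs.exists_pathList_of_reachable
      (SimpleGraph.ConnectedComponent.exact (ht.trans ht'.symm))
    refine ⟨t.1 :: (l ++ [s]), ⟨⟨?_, ?_⟩, t.1 :: l, s, rfl, hs, hJ⟩, l, rfl⟩
    · rw [← List.cons_append, List.isChain_append]
      refine ⟨hp.1, by simp, fun x hx y hy => ?_⟩
      simp only [List.head?_cons, Option.mem_some_iff] at hy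
      subst hy
      rw [Option.mem_unique hx hlast]
      exact hadj.symm
    · rw [← List.cons_append, List.nodup_append]
      refine ⟨hp.2, by simp, fun x hx y hy e => ?_⟩
      rw [List.mem_singleton] at hy
      subst hy e
      exact hs (hJ x hx)

/-- The first letter of the path gives `t` and with it the component, while the last letter gives
the copy. -/
theorem IsPathOf.vertex_eq {d d' : (cs.pairGraph J).DupVertex} {l : List B}
    (h : cs.IsPathOf d l) (h' : cs.IsPathOf d' l) : d = d' := by
  rcases d with ⟨a, ha⟩ | ⟨C, ⟨s, hs⟩, ⟨⟨t, htb⟩, ht⟩⟩ <;>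
    rcases d' with ⟨a', ha'⟩ | ⟨C', ⟨s', hs'⟩, ⟨⟨t', htb'⟩, ht'⟩⟩
  · have : [a] = [a'] := h.symm.trans h'
    simp only [List.cons.injEq, and_true] at this
    subst this
    rfl
  · obtain ⟨m, hm⟩ := h'
    have : [a] = _ := h.symm.trans hm
    simp at this
  · obtain ⟨m, hm⟩ := h
    have : [a'] = _ := h'.symm.trans hm
    simp at this
  · obtain ⟨m, hm⟩ := h
    obtain ⟨m', hm'⟩ := h'
    have := hm.symm.trans hm'
    simp only [List.cons.injEq] at this
    obtain ⟨rfl, h2⟩ := this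
    obtain ⟨-, h3⟩ := List.append_inj' h2 rfl
    simp only [List.cons.injEq, and_true] at h3
    subst h3
    obtain rfl : C = C' := ht.symm.trans ht'
    rfl

theorem exists_vertex {l : List B} (h : IsWhitePath M J l) :
    ∃ d : (cs.pairGraph J).DupVertex, cs.IsPathOf d l := by
  obtain ⟨hp, m, s, rfl, hs, hm⟩ := h
  rcases m with _ | ⟨t, m⟩
  · exact ⟨.inl ⟨s, hs⟩, rfl⟩
  obtain ⟨u, hu, hus⟩ : ∃ u ∈ t :: m, M.coxeterGraph.Adj s u := by
    obtain ⟨-, -, h3⟩ := List.isChain_append.1 hp.1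
    refine ⟨(t :: m).getLast (by simp), List.getLast_mem _, (h3 _ ?_ s (by simp)).symm⟩
    rw [List.getLast?_eq_getLast_of_ne_nil (by simp)]
    simp
  have hs' : s ∈ (cs.pairGraph J).blackNeighbours
      ((cs.pairGraph J).whiteGraph.connectedComponentMk
        ⟨t, cs.pairGraph_white_of_mem (hm t (by simp))⟩) :=
    ⟨hs, ⟨u, cs.pairGraph_white_of_mem (hm u hu)⟩, SimpleGraph.ConnectedComponent.sound
      (cs.reachable_of_isChain hp.1.left_of_append hm hu).symm, hus⟩
  exact ⟨.inr ⟨_, ⟨s, hs'⟩, ⟨⟨t, _⟩, rfl⟩⟩, m, rfl⟩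

/-- The vertex fixes both ends of the path, and an acyclic graph has at most one path between them.
-/
theorem IsPathOf.path_eq (hG : M.coxeterGraph.IsAcyclic) {d : (cs.pairGraph J).DupVertex}
    {l l' : List B} (hl : IsWhitePath M J l) (hl' : IsWhitePath M J l')
    (h : cs.IsPathOf d l) (h' : cs.IsPathOf d l') : l = l' := by
  refine hG.pathList_unique hl.1 hl'.1 hl.ne_nil hl'.ne_nil ?_ ?_ <;> rcases d with a | y
  · cases h; cases h'; rfl
  · obtain ⟨m, rfl⟩ := h
    obtain ⟨m', rfl⟩ := h'
    rfl
  · cases h; cases h'; rfl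
  · obtain ⟨m, rfl⟩ := h
    obtain ⟨m', rfl⟩ := h'
    simp

theorem entry_eq_dupEntry (hG : M.coxeterGraph.IsAcyclic)
    (hJ : ∀ s ∈ J, ∀ t, M.coxeterGraph.Adj s t → M s t = 3) {d d' : (cs.pairGraph J).DupVertex}
    {l l' : List B} (hl : IsWhitePath M J l) (hl' : IsWhitePath M J l')
    (h : cs.IsPathOf d l) (h' : cs.IsPathOf d' l') :
    entry (ShortestRep.ofPath cs hl) (ShortestRep.ofPath cs hl') =
      (cs.pairGraph J).dupEntry d d' := by
  rcases d with a | ⟨C, ⟨s, hs⟩, ⟨⟨t, htb⟩, ht⟩⟩ <;>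
    rcases d' with a' | ⟨C', ⟨s', hs'⟩, ⟨⟨t', htb'⟩, ht'⟩⟩
  · cases h; cases h'
    exact cs.entry_singleton_singleton hG hl hl'
  · cases h
    obtain ⟨m, rfl⟩ := h'
    exact cs.entry_singleton_cons hG hJ hl hl' (by simp)
  · cases h'
    obtain ⟨m, rfl⟩ := h
    rw [entry_comm, cs.entry_singleton_cons hG hJ hl' hl (by simp)]
    exact M.symmetric _ _
  · have htJ : t ∈ J := cs.mem_of_pairGraph_white htb
    have htJ' : t' ∈ J := cs.mem_of_pairGraph_white htb'
    have hCC : M.coxeterGraph.Adj t t' → C = C' := fun hadj => by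
      rw [← ht, ← ht']
      exact SimpleGraph.ConnectedComponent.sound (SimpleGraph.Adj.reachable hadj)
    obtain ⟨m, rfl⟩ := h
    obtain ⟨m', rfl⟩ := h'
    dsimp only at hl hl' ⊢
    have hlast : ∀ {p q : List B}, p ++ [s] = q ++ [s'] → s = s' := fun he => by
      simpa using (List.append_inj' he rfl).2
    have hunique : ∀ {p q : List B}, IsWhitePath M J (p ++ [s]) → IsWhitePath M J (q ++ [s]) →
        (p ++ [s]).head? = (q ++ [s]).head? → p ++ [s] = q ++ [s] := fun hp hq he => by
      refine hG.pathList_unique hp.1 hq.1 hp.ne_nil hq.ne_nil ?_ (by simp)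
      rwa [List.head?_eq_some_head hp.ne_nil, List.head?_eq_some_head hq.ne_nil,
        Option.some_inj] at he
    -- White paths differing by one initial vertex have the same end `s`, so different copies are
    -- not joined. Within one copy, if `t` and `t'` are adjacent, one path prolongs the other,
    -- according to whether `t` lies on the path from `t'`.
    have key : (∃ i, t :: (m ++ [s]) = i :: t' :: (m' ++ [s'])) ∨
        (∃ i, t' :: (m' ++ [s']) = i :: t :: (m ++ [s])) ↔
        M.coxeterGraph.Adj t t' ∧ s = s' := by
      constructor
      · rintro (⟨i, hi⟩ | ⟨i, hi⟩)
        · obtain ⟨rfl, h2⟩ := List.cons.inj hi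
          have hl2 := hl
          rw [h2] at hl2
          exact ⟨(isWhitePath_cons_cons.1 hl2).2.2.1, hlast (q := t' :: m') h2⟩
        · obtain ⟨rfl, h2⟩ := List.cons.inj hi
          have hl2 := hl'
          rw [h2] at hl2
          exact ⟨(isWhitePath_cons_cons.1 hl2).2.2.1.symm, hlast (p := t :: m) h2.symm⟩
      · rintro ⟨hadj, rfl⟩
        by_cases hmem : t ∈ t' :: (m' ++ [s])
        · right
          refine ⟨t', congrArg (t' :: ·) ?_⟩
          obtain ⟨z, r, hzr⟩ : ∃ z r, m' ++ [s] = z :: r :=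
            List.exists_cons_of_ne_nil (by simp)
          have htz : t = z := hG.eq_head_of_adj (x := t') (l := r) (hzr ▸ hl'.1)
            (hzr ▸ (List.mem_cons.1 hmem).resolve_left hadj.ne) hadj.symm
          exact hunique (q := t :: m) (hl'.of_append (a := [t']) (by simp)) hl
            (by rw [hzr, htz]; rfl)
        · left
          exact ⟨t, hunique (p := t :: m) (q := t :: t' :: m') hl
            (isWhitePath_cons_cons.2 ⟨htJ, hmem, hadj, hl'⟩) rfl⟩
    refine (cs.entry_cons_cons hG hl hl' (by simp) (by simp)).trans ?_
    classical
    change _ = if C = C' ∧ s = s' then M t t' else 2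
    by_cases hss : s = s'
    · subst hss
      by_cases htt : t = t'
      · subst htt
        rw [if_pos (show t :: (m ++ [s]) = t :: (m' ++ [s]) from
          hunique (p := t :: m) (q := t :: m') hl hl' rfl), if_pos ⟨ht.symm.trans ht', rfl⟩]
        exact (M.diagonal t).symm
      · rw [if_neg fun he => htt (List.cons.inj he).1]
        by_cases hadj : M.coxeterGraph.Adj t t'
        · rw [if_pos (key.2 ⟨hadj, rfl⟩), if_pos ⟨hCC hadj, rfl⟩]
          exact (hJ t htJ t' hadj).symm
        · have h2 : M t t' = 2 := by
            by_contra h2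
            exact hadj ⟨htt, h2⟩
          rw [if_neg fun h => hadj (key.1 h).1]
          split_ifs
          · exact h2.symm
          · rfl
    · rw [if_neg (show t :: (m ++ [s]) ≠ t' :: (m' ++ [s']) from
        fun he => hss (hlast (p := t :: m) (q := t' :: m') he)),
        if_neg fun h => hss (key.1 h).2, if_neg fun h => hss h.2]

/-- The bijection between the vertices of the duplicated graph and those of the graph of `W^J`. -/
theorem exists_dupEquiv (hG : M.coxeterGraph.IsAcyclic)
    (hJ : ∀ s ∈ J, ∀ t, M.coxeterGraph.Adj s t → M s t = 3) :
    ∃ e : (cs.pairGraph J).DupVertex ≃ VX (cs.ShortestRep J), ∀ d, ∃ l, ∃ h : IsWhitePath M J l,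
      cs.IsPathOf d l ∧ (e d).1 = ShortestRep.ofPath cs h := by
  choose L hL hL' using cs.exists_isPathOf (J := J)
  refine ⟨Equiv.ofBijective (fun d => ⟨ShortestRep.ofPath cs (hL d), cs.ofPath_mem_VX hG (hL d)⟩)
    ⟨fun d d' h => ?_, fun ⟨x, hx⟩ => ?_⟩, fun d => ⟨L d, hL d, hL' d, rfl⟩⟩
  · have := cs.ofPath_injective (hL d) (hL d') (congrArg Subtype.val h)
    exact (hL' d).vertex_eq cs (this ▸ hL' d')
  · obtain ⟨l, hl, rfl⟩ := cs.exists_ofPath_of_mem_VX hG hJ hx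
    obtain ⟨d, hd⟩ := cs.exists_vertex hl
    exact ⟨d, Subtype.ext (by simp only [(hL' d).path_eq cs hG (hL d) hl hd])⟩

end CoxeterSystem

open CoxeterSystem in
theorem theorem3p7 {B W : Type*} [Group W] {M : CoxeterMatrix B} (cs : CoxeterSystem M W)
    (J : Set B) (hsimple : M.coxeterGraph.IsTree)
    (hJ : ∀ s ∈ J, ∀ t, M.coxeterGraph.Adj s t → M s t = 3) :
    ∃ e : (cs.pairGraph J).duplicate.Iso (PointedPoset.bwGraph (cs.ShortestRep J)),
      ∀ s : ↥(cs.pairGraph J).black, (e.toEquiv (Sum.inl s)).1.1 = cs.simple (s : B) := by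
  obtain ⟨e, he⟩ := cs.exists_dupEquiv hsimple.isAcyclic hJ
  refine ⟨⟨e, fun x y => ?_, fun x => ?_⟩, fun s => ?_⟩
  · obtain ⟨l, hl, h, hx⟩ := he x
    obtain ⟨l', hl', h', hy⟩ := he y
    change PointedPoset.entry (e x).1 (e y).1 = _
    rw [hx, hy]
    exact cs.entry_eq_dupEntry hsimple.isAcyclic hJ hl hl' h h'
  · obtain ⟨l, hl, h, hx⟩ := he x
    change (e x).1 ∈ PointedPoset.layer _ 1 ↔ x ∈ Set.range Sum.inl
    rw [hx, ofPath_mem_layer_one_iff]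
    rcases x with a | y
    · cases h
      simp
    · obtain ⟨m, rfl⟩ := h
      simp
  · obtain ⟨l, hl, h, hx⟩ := he (Sum.inl s)
    cases h
    refine (congrArg Subtype.val hx).trans ?_
    exact cs.wordProd_singleton _
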